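/- Let $\pi=\pi_1\cdots\pi_n$ be an irreducible permutation of $\{1,\dots,n\}$, i.e. there is no $1\le k<n$ such that $\pi_1\cdots\pi_k$ is a permutation of $\{1,\dots,k\}$. A non-ambiguous tree is a filling of a rectangular grid in which each cell is dotted or not, such that every row and every column contains a dot, and every dot outside the top-left cell has either a dot above it in its column or a dot to its left in its row, but not both. It is complete (a CNAT) if every dot has both a dot below it in its column and a dot to its right in its row, or neither; the dots with neither are its leaves. Number columns from left to right and rows from top to bottom. We say that $\pi$ has exactly $c$ CNATs if there are exactly $c$ CNATs in the $n\times n$ grid whose set of leaves is $\{(\text{column } i,\ \text{row } \pi_i) : 1\le i\le n\}$. An occurrence in $\pi$ of a pattern $\tau=\tau_1\cdots\tau_k$ is given by positions $i_1<\dots<i_k$ such that $\pi_{i_1},\dots,\pi_{i_k}$ are in the same relative order as $\tau_1,\dots,\tau_k$; $\pi$ avoids $\tau$ if it has no occurrence of $\tau$. Then $\pi$ has exactly $3$ CNATs if and only if $\pi$ contains exactly one occurrence of $3412$ and avoids $321$. Moreover, in this case, if $\pi_i,\pi_j,\pi_k,\pi_\ell$ with $i<j<k<\ell$ is the occurrence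 of $3412$, then $k=j+1$ and $\pi_i=\pi_\ell+1$. -/

import Mathlib

namespace CNATPattern

/-- A filling of a rectangular grid with `m` rows and `n` columns, given by its set of dotted cells.
A cell is a pair `(column, row)`; columns are numbered from left to right, rows from top to
bottom. -/
abbrev Filling (m n : ℕ) := Finset (Fin n × Fin m)

variable {m n : ℕ}

/-- There is a dotted cell above `d` in the same column. -/
def HasAbove (T : Filling m n) (d : Fin n × Fin m) : Prop := ∃ r, r < d.2 ∧ (d.1, r) ∈ T

/-- There is a dotted cell below `d` in the same column. -/
def HasBelow (T : Filling m n) (d : Fin n × Fin m) : Prop := ∃ r, d.2 < r ∧ (d.1, r) ∈ T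

/-- There is a dotted cell to the left of `d` in the same row. -/
def HasLeft (T : Filling m n) (d : Fin n × Fin m) : Prop := ∃ c, c < d.1 ∧ (c, d.2) ∈ T

/-- There is a dotted cell to the right of `d` in the same row. -/
def HasRight (T : Filling m n) (d : Fin n × Fin m) : Prop := ∃ c, d.1 < c ∧ (c, d.2) ∈ T

/-- The top-left cell of the grid. -/
def IsTopLeft (d : Fin n × Fin m) : Prop := (d.1 : ℕ) = 0 ∧ (d.2 : ℕ) = 0

/-- Non-ambiguous trees: every row and every column contains a dot, and every dot outside the
top-left cell has a dot above it or a dot to its left, but not both. -/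
structure IsNAT (T : Filling m n) : Prop where
  row_nonempty : ∀ r : Fin m, ∃ c : Fin n, (c, r) ∈ T
  col_nonempty : ∀ c : Fin n, ∃ r : Fin m, (c, r) ∈ T
  unique_parent : ∀ d ∈ T, ¬ IsTopLeft d → Xor (HasAbove T d) (HasLeft T d)

/-- Complete non-ambiguous trees: every dot has both a dot below it and a dot to its right,
or neither of these. -/
structure IsCNAT (T : Filling m n) : Prop extends IsNAT T where
  complete : ∀ d ∈ T, (HasBelow T d ∧ HasRight T d) ∨ (¬ HasBelow T d ∧ ¬ HasRight T d)

/-- A leaf dot: no dot below it in its column and no dot to its right in its row. -/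
def IsLeaf (T : Filling m n) (d : Fin n × Fin m) : Prop :=
  d ∈ T ∧ ¬ HasBelow T d ∧ ¬ HasRight T d

/-- `π` is the permutation associated with `T`: the leaf dots of `T` form the graphical
representation of `π`, which has a dot in column `i` and row `π i` for every `i`. -/
def IsAssociated (T : Filling n n) (π : Equiv.Perm (Fin n)) : Prop :=
  ∀ d : Fin n × Fin n, IsLeaf T d ↔ d.2 = π d.1

/-- The set of complete non-ambiguous trees whose associated permutation is `π`. -/
def CNAT (π : Equiv.Perm (Fin n)) : Set (Filling n n) := {T | IsCNAT T ∧ IsAssociated T π}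

/-- The number of complete non-ambiguous trees whose associated permutation is `π`. -/
noncomputable def cnat (π : Equiv.Perm (Fin n)) : ℕ := (CNAT π).ncard

/-- `π` is reducible if, for some `1 ≤ k < n`, its first `k` letters are the `k` smallest ones. -/
def Reducible (π : Equiv.Perm (Fin n)) : Prop :=
  ∃ k : ℕ, 1 ≤ k ∧ k < n ∧ π '' {i : Fin n | (i : ℕ) < k} = {i : Fin n | (i : ℕ) < k}

/-- The positions `f 0 < f 1 < ⋯` carry letters of `π` in the same relative order as `τ`. -/
def IsOccurrence {k : ℕ} (τ : Equiv.Perm (Fin k)) (π : Equiv.Perm (Fin n)) (f : Fin k → Fin n) :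
    Prop :=
  StrictMono f ∧ ∀ a b, π (f a) < π (f b) ↔ τ a < τ b

/-- `π` avoids the pattern `τ`. -/
def Avoids {k : ℕ} (π : Equiv.Perm (Fin n)) (τ : Equiv.Perm (Fin k)) : Prop :=
  ¬ ∃ f, IsOccurrence τ π f

/-- The permutation `321` (letters shifted to start at `0`). -/
def p321 : Equiv.Perm (Fin 3) := ⟨![2, 1, 0], ![2, 1, 0], by decide, by decide⟩

/-- The permutation `3412` (letters shifted to start at `0`). -/
def p3412 : Equiv.Perm (Fin 4) := ⟨![2, 3, 0, 1], ![2, 3, 0, 1], by decide, by decide⟩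

end CNATPattern

/-! The leaf of column `a` is its lowest dot and the leaf of row `π b` is its rightmost dot, so
every other dot (column `a`, row `π b`) is an inversion of `π`, that is, an edge of the inversion
graph on positions. In this way CNATs correspond to spanning trees of the inversion graph in which
no dot has two parents (`Good`, `cnat_eq_count`). Irreducibility makes the graph connected
(`cut_univ`).

Trees are counted by adding vertices one at a time. A vertex `v` adjacent to `P` extends every good
tree on `P` along one fixed edge, so the count never decreases (`exists_attach`, `Cut.count_le`). It
stays the same when `v` has one neighbour in `P` (`count_insert_le`). It grows when `v` has two
(`Cut.count_lt_count_insert`), and at least doubles when `v` has a neighbour on each side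
(`count_insert_of_mixed`). A vertex with two neighbours in a connected set closes a triangle, which
is a `321`, or lies in a `3412` (`Cut.triangle_or_pat`).

A `3412` carries exactly 3 trees and a `321` exactly 2. Starting from a `3412`, the total is 3
precisely when no later vertex closes a cycle, that is, when there is no second `3412` and no `321`.
If there is no `3412`, one triangle gives 2, two triangles give at least 4
(`Cut.four_le_count_of_triangles`), and no triangle gives at most 1, so 3 never occurs. Adjacency of
the inner letters holds because a letter in between would create a second `3412` or a `321`. -/

namespace InversionTree

/-! ### Good trees and their restrictions -/

variable {V : Type*}

/-- `a` lies to the left of `b` and carries a larger value. -/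
def Inv (x y : V → ℕ) (a b : V) : Prop := x a < x b ∧ y b < y a

/-- Adjacency in the inversion graph. -/
def Adj (x y : V → ℕ) (a b : V) : Prop := Inv x y a b ∨ Inv x y b a

/-- The inversion graph induced on `P` is connected. -/
def Cut (x y : V → ℕ) (P : Finset V) : Prop :=
  ∀ A ⊆ P, A.Nonempty → A ≠ P → ∃ a ∈ A, ∃ b ∈ P, b ∉ A ∧ Adj x y a b

/-- `S` is a spanning tree of the inversion graph induced on `P` such that no vertex is both a left
and a right endpoint, and no edge has both a smaller edge with the same left endpoint and one with
the same right endpoint. -/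
structure Good (x y : V → ℕ) (P : Finset V) (S : Finset (V × V)) : Prop where
  mem_inv : ∀ a b, (a, b) ∈ S → a ∈ P ∧ b ∈ P ∧ Inv x y a b
  pure : ∀ a b c, (a, b) ∈ S → (b, c) ∈ S → False
  corner : ∀ a a' b b', (a, b) ∈ S → (a, b') ∈ S → (a', b) ∈ S → x a' < x a → y b' < y b → False
  conn : ∀ A ⊆ P, A.Nonempty → A ≠ P →
    ∃ a b, (a, b) ∈ S ∧ (a ∈ A ∧ b ∉ A ∨ a ∉ A ∧ b ∈ A)
  card : S.card + 1 = P.card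

/-- The number of good trees on `P`. -/
noncomputable def count (x y : V → ℕ) (P : Finset V) : ℕ := {S | Good x y P S}.ncard

/-- The edges of `S'` inside `Q` are those of `S`. -/
def Extends (Q : Finset V) (S S' : Finset (V × V)) : Prop :=
  ∀ a b, (a, b) ∈ S ↔ (a, b) ∈ S' ∧ a ∈ Q ∧ b ∈ Q

variable {x y : V → ℕ} {P Q : Finset V} {S S' : Finset (V × V)}

theorem Inv.trans {a b c : V} (h : Inv x y a b) (h' : Inv x y b c) : Inv x y a c :=
  ⟨h.1.trans h'.1, h'.2.trans h.2⟩

theorem Inv.ne {a b : V} (h : Inv x y a b) : a ≠ b := by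
  rintro rfl; exact lt_irrefl _ h.1

theorem Inv.asymm {a b : V} (h : Inv x y a b) (h' : Inv x y b a) : False := lt_asymm h.1 h'.1

theorem Adj.symm {a b : V} (h : Adj x y a b) : Adj x y b a := Or.symm h

theorem Adj.ne {a b : V} (h : Adj x y a b) : a ≠ b := by
  rcases h with h | h
  · exact h.ne
  · exact h.ne.symm

theorem Good.cut (h : Good x y P S) : Cut x y P := by
  intro A hA hne hAP
  obtain ⟨a, b, hab, h1 | h1⟩ := h.conn A hA hne hAP
  · exact ⟨a, h1.1, b, (h.mem_inv a b hab).2.1, h1.2, Or.inl (h.mem_inv a b hab).2.2⟩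
  · exact ⟨b, h1.2, a, (h.mem_inv a b hab).1, h1.1, Or.inr (h.mem_inv a b hab).2.2⟩

theorem Good.nonempty (h : Good x y P S) : P.Nonempty := by
  rw [← Finset.card_pos, ← h.card]; omega

theorem Good.extends_self (h : Good x y P S) : Extends P S S := fun a b =>
  ⟨fun hab => ⟨hab, (h.mem_inv a b hab).1, (h.mem_inv a b hab).2.1⟩, fun hab => hab.1⟩

theorem Extends.trans {S'' : Finset (V × V)} (h : Extends Q S S') (h' : Extends P S' S'')
    (hQP : Q ⊆ P) : Extends Q S S'' := by
  intro a b
  rw [h a b, h' a b]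
  constructor
  · rintro ⟨⟨h1, -, -⟩, h2⟩; exact ⟨h1, h2⟩
  · rintro ⟨h1, h2, h3⟩; exact ⟨⟨h1, hQP h2, hQP h3⟩, h2, h3⟩

theorem Extends.unique {S₁ S₂ : Finset (V × V)} (h₁ : Extends Q S₁ S) (h₂ : Extends Q S₂ S) :
    S₁ = S₂ := by
  ext ⟨a, b⟩
  rw [h₁ a b, h₂ a b]

/-- Restriction to the edges inside `Q` undoes the extension, so choosing extensions is injective.
-/
theorem count_le_count [Finite V]
    (h : ∀ S, Good x y Q S → ∃ S', Good x y P S' ∧ Extends Q S S') :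
    count x y Q ≤ count x y P := by
  choose! f hf hfe using h
  refine Set.ncard_le_ncard_of_injOn f (fun S hS => hf S hS) ?_ (Set.toFinite _)
  intro S₁ h₁ S₂ h₂ he
  have := hfe S₁ h₁
  rw [he] at this
  exact this.unique (hfe S₂ h₂)

/-- Restriction recovers `S` from either extension, so both choices are injective, and a tree in
both images would come twice from the same `S`. -/
theorem two_mul_count_le_count [Finite V]
    (h : ∀ S, Good x y Q S → ∃ S₁ S₂, Good x y P S₁ ∧ Good x y P S₂ ∧ Extends Q S S₁ ∧
      Extends Q S S₂ ∧ S₁ ≠ S₂) :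
    2 * count x y Q ≤ count x y P := by
  choose! f g hf hg hfe hge hne using h
  have hfi : Set.InjOn f {S | Good x y Q S} := by
    intro S₁ h₁ S₂ h₂ he
    have := hfe S₁ h₁
    rw [he] at this
    exact this.unique (hfe S₂ h₂)
  have hgi : Set.InjOn g {S | Good x y Q S} := by
    intro S₁ h₁ S₂ h₂ he
    have := hge S₁ h₁
    rw [he] at this
    exact this.unique (hge S₂ h₂)
  have hd : Disjoint (f '' {S | Good x y Q S}) (g '' {S | Good x y Q S}) := by
    rw [Set.disjoint_left]
    rintro _ ⟨S₁, h₁, rfl⟩ ⟨S₂, h₂, he⟩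
    have := hge S₂ h₂
    rw [he] at this
    obtain rfl := this.unique (hfe S₁ h₁)
    exact hne _ h₁ he.symm
  have hu := Set.ncard_union_eq hd (Set.toFinite _) (Set.toFinite _)
  rw [hfi.ncard_image, hgi.ncard_image, ← two_mul] at hu
  unfold count
  rw [← hu]
  refine Set.ncard_le_ncard ?_ (Set.toFinite _)
  rintro _ (⟨S, hS, rfl⟩ | ⟨S, hS, rfl⟩)
  · exact hf S hS
  · exact hg S hS

theorem good_singleton (v : V) : Good x y {v} ∅ where
  mem_inv := by simp
  pure := by simp
  corner := by simp
  conn := by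
    intro A hA hne hAP
    exact absurd (hne.subset_singleton_iff.mp hA) hAP
  card := by simp

theorem exists_lowest {u v : V} (hu : u ∈ P) (huv : Inv x y v u) :
    ∃ w ∈ P, Inv x y v w ∧ ∀ w' ∈ P, Inv x y v w' → y w ≤ y w' := by
  classical
  obtain ⟨w, hw, hm⟩ := Finset.exists_min_image (P.filter (Inv x y v)) y ⟨u, by simp [hu, huv]⟩
  rw [Finset.mem_filter] at hw
  exact ⟨w, hw.1, hw.2, fun w' h1 h2 => hm w' (by simp [h1, h2])⟩

theorem exists_leftmost {u v : V} (hu : u ∈ P) (huv : Inv x y u v) :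
    ∃ w ∈ P, Inv x y w v ∧ ∀ w' ∈ P, Inv x y w' v → x w ≤ x w' := by
  classical
  obtain ⟨w, hw, hm⟩ := Finset.exists_min_image (P.filter (Inv x y · v)) x ⟨u, by simp [hu, huv]⟩
  rw [Finset.mem_filter] at hw
  exact ⟨w, hw.1, hw.2, fun w' h1 h2 => hm w' (by simp [h1, h2])⟩

theorem Cut.exists_adj (hP : Cut x y P) (hQP : Q ⊆ P) (hQ : Q.Nonempty) (hne : Q ≠ P) :
    ∃ v ∈ P, v ∉ Q ∧ ∃ u ∈ Q, Adj x y v u := by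
  obtain ⟨u, hu, v, hv, hvQ, h⟩ := hP Q hQP hQ hne
  exact ⟨v, hv, hvQ, u, hu, h.symm⟩

/-! ### Attaching and removing leaves -/

variable [DecidableEq V]

theorem Good.conn_insert (h : Good x y P S) {u v : V} (hv : v ∉ P) (hu : u ∈ P) {e : V × V}
    (he : e = (v, u) ∨ e = (u, v)) (A : Finset V) (hA : A ⊆ insert v P) (hne : A.Nonempty)
    (hAP : A ≠ insert v P) :
    ∃ a b, (a, b) ∈ insert e S ∧ (a ∈ A ∧ b ∉ A ∨ a ∉ A ∧ b ∈ A) := by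
  have hvu : u ≠ v := fun h => hv (h ▸ hu)
  -- If the cut separates `u` from `v`, the new edge crosses it; otherwise dropping `v` leaves a
  -- proper cut of `P`.
  by_cases huv : u ∈ A ↔ v ∈ A
  · have hA' : A.erase v ⊆ P := by
      intro a ha
      rw [Finset.mem_erase] at ha
      exact (Finset.mem_insert.mp (hA ha.2)).resolve_left ha.1
    have hne' : (A.erase v).Nonempty := by
      by_cases hvA : v ∈ A
      · exact ⟨u, by simp [hvu, huv.mpr hvA]⟩
      · rwa [Finset.erase_eq_of_notMem hvA]
    have hAP' : A.erase v ≠ P := by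
      intro h1
      have huA : u ∈ A.erase v := h1 ▸ hu
      have hvA := huv.mp (Finset.mem_of_mem_erase huA)
      exact hAP (by rw [← h1, Finset.insert_erase hvA])
    obtain ⟨a, b, hab, h1⟩ := h.conn _ hA' hne' hAP'
    have ha : a ≠ v := fun h2 => hv (h2 ▸ (h.mem_inv a b hab).1)
    have hb : b ≠ v := fun h2 => hv (h2 ▸ (h.mem_inv a b hab).2.1)
    refine ⟨a, b, Finset.mem_insert_of_mem hab, ?_⟩
    simpa [ha, hb] using h1
  · rcases he with rfl | rfl
    · exact ⟨v, u, by simp, by tauto⟩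
    · exact ⟨u, v, by simp, by tauto⟩

/-- Minimality of `u` protects both local conditions: an edge leaving `u`, or an edge lying below an
existing edge that ends at `u` and starts to the right of `v`, would lead to a neighbour of `v`
lower than `u`. -/
theorem Good.attach_right (h : Good x y P S) {u v : V} (hv : v ∉ P) (hu : u ∈ P)
    (huv : Inv x y v u) (hmin : ∀ w ∈ P, Inv x y v w → y u ≤ y w) :
    Good x y (insert v P) (insert (v, u) S) where
  mem_inv := by
    intro a b hab
    rw [Finset.mem_insert, Prod.mk.injEq] at hab
    rcases hab with ⟨rfl, rfl⟩ | hab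
    · exact ⟨by simp, by simp [hu], huv⟩
    · obtain ⟨h1, h2, h3⟩ := h.mem_inv a b hab
      exact ⟨by simp [h1], by simp [h2], h3⟩
  pure := by
    intro a b c hab hbc
    rw [Finset.mem_insert, Prod.mk.injEq] at hab hbc
    rcases hab with ⟨rfl, rfl⟩ | hab <;> rcases hbc with ⟨rfl, rfl⟩ | hbc
    · exact huv.ne rfl
    · obtain ⟨-, h2, h3⟩ := h.mem_inv _ _ hbc
      have := hmin c h2 (huv.trans h3)
      have := h3.2
      omega
    · exact hv (h.mem_inv _ _ hab).2.1
    · exact h.pure a b c hab hbc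
  corner := by
    intro a a' b b' h1 h2 h3 hx hy
    have hvS : ∀ w, (v, w) ∉ S := fun w hw => hv (h.mem_inv _ _ hw).1
    rw [Finset.mem_insert, Prod.mk.injEq] at h1 h2 h3
    rcases h1 with ⟨rfl, rfl⟩ | h1
    · rcases h2 with ⟨-, rfl⟩ | h2
      · omega
      · exact hvS _ h2
    · rcases h2 with ⟨rfl, rfl⟩ | h2
      · exact hvS _ h1
      · rcases h3 with ⟨rfl, rfl⟩ | h3
        · obtain ⟨-, h4, h5⟩ := h.mem_inv _ _ h2
          have := hmin b' h4 ⟨hx.trans h5.1, hy.trans huv.2⟩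
          omega
        · exact h.corner a a' b b' h1 h2 h3 hx hy
  conn := h.conn_insert hv hu (Or.inl rfl)
  card := by
    have hvS : (v, u) ∉ S := fun hw => hv (h.mem_inv _ _ hw).1
    rw [Finset.card_insert_of_notMem hvS, Finset.card_insert_of_notMem hv, h.card]

theorem Good.attach_left (h : Good x y P S) {u v : V} (hv : v ∉ P) (hu : u ∈ P)
    (huv : Inv x y u v) (hmin : ∀ w ∈ P, Inv x y w v → x u ≤ x w) :
    Good x y (insert v P) (insert (u, v) S) where
  mem_inv := by
    intro a b hab
    rw [Finset.mem_insert, Prod.mk.injEq] at hab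
    rcases hab with ⟨rfl, rfl⟩ | hab
    · exact ⟨by simp [hu], by simp, huv⟩
    · obtain ⟨h1, h2, h3⟩ := h.mem_inv a b hab
      exact ⟨by simp [h1], by simp [h2], h3⟩
  pure := by
    intro a b c hab hbc
    rw [Finset.mem_insert, Prod.mk.injEq] at hab hbc
    rcases hab with ⟨rfl, rfl⟩ | hab <;> rcases hbc with ⟨rfl, rfl⟩ | hbc
    · exact huv.ne rfl
    · exact hv (h.mem_inv _ _ hbc).1
    · obtain ⟨h2, -, h3⟩ := h.mem_inv _ _ hab
      have := hmin a h2 (h3.trans huv)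
      have := h3.1
      omega
    · exact h.pure a b c hab hbc
  corner := by
    intro a a' b b' h1 h2 h3 hx hy
    have hvS : ∀ w, (w, v) ∉ S := fun w hw => hv (h.mem_inv _ _ hw).2.1
    rw [Finset.mem_insert, Prod.mk.injEq] at h1 h2 h3
    rcases h1 with ⟨rfl, rfl⟩ | h1
    · rcases h3 with ⟨rfl, -⟩ | h3
      · omega
      · exact hvS _ h3
    · rcases h3 with ⟨rfl, rfl⟩ | h3
      · exact hvS _ h1
      · rcases h2 with ⟨rfl, rfl⟩ | h2
        · obtain ⟨h4, -, h5⟩ := h.mem_inv _ _ h3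
          have := hmin a' h4 ⟨hx.trans huv.1, hy.trans h5.2⟩
          omega
        · exact h.corner a a' b b' h1 h2 h3 hx hy
  conn := h.conn_insert hv hu (Or.inr rfl)
  card := by
    have hvS : (u, v) ∉ S := fun hw => hv (h.mem_inv _ _ hw).2.1
    rw [Finset.card_insert_of_notMem hvS, Finset.card_insert_of_notMem hv, h.card]

theorem Good.extends_insert (h : Good x y P S) {v : V} (hv : v ∉ P) {e : V × V}
    (he : e.1 = v ∨ e.2 = v) : Extends P S (insert e S) := by
  intro a b
  rw [Finset.mem_insert]
  constructor
  · intro hab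
    exact ⟨Or.inr hab, (h.mem_inv a b hab).1, (h.mem_inv a b hab).2.1⟩
  · rintro ⟨rfl | hab, ha, hb⟩
    · rcases he with rfl | rfl
      · exact absurd ha hv
      · exact absurd hb hv
    · exact hab

/-- A vertex adjacent to `P` can be attached, as a leaf, to every good tree on `P`, always along
the same edge. -/
theorem exists_attach {u v : V} (hv : v ∉ P) (hu : u ∈ P) (huv : Adj x y v u) :
    ∃ e : V × V, (e.1 = v ∨ e.2 = v) ∧
      ∀ S, Good x y P S → Good x y (insert v P) (insert e S) := by
  rcases huv with huv | huv
  · obtain ⟨w, hw, h1, h2⟩ := exists_lowest hu huv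
    exact ⟨(v, w), Or.inl rfl, fun S hS => hS.attach_right hv hw h1 h2⟩
  · obtain ⟨w, hw, h1, h2⟩ := exists_leftmost hu huv
    exact ⟨(w, v), Or.inr rfl, fun S hS => hS.attach_left hv hw h1 h2⟩

/-- Connectivity always supplies an outside vertex adjacent to the current set; attach such vertices
as leaves until `P` is exhausted. -/
theorem Cut.exists_extends (hP : Cut x y P) {Q : Finset V} {S : Finset (V × V)} (hQP : Q ⊆ P)
    (h : Good x y Q S) :
    ∃ S', Good x y P S' ∧ Extends Q S S' := by
  by_cases hne : Q = P
  · subst hne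
    exact ⟨S, h, h.extends_self⟩
  · obtain ⟨v, hvP, hv, u, hu, huv⟩ := hP.exists_adj hQP h.nonempty hne
    obtain ⟨e, he, hgood⟩ := exists_attach hv hu huv
    have hlt : (P \ insert v Q).card < (P \ Q).card := by
      apply Finset.card_lt_card
      refine Finset.ssubset_iff_subset_ne.mpr ⟨Finset.sdiff_subset_sdiff le_rfl (by simp), ?_⟩
      intro h1
      have : v ∈ P \ insert v Q := h1 ▸ (by simp [hvP, hv])
      simp at this
    obtain ⟨S', hS', hext⟩ := Cut.exists_extends hP (Finset.insert_subset hvP hQP) (hgood S h)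
    exact ⟨S', hS', (h.extends_insert hv he).trans hext (Finset.subset_insert _ _)⟩
termination_by (P \ Q).card

theorem Cut.count_le [Finite V] (hP : Cut x y P) (hQP : Q ⊆ P) : count x y Q ≤ count x y P :=
  count_le_count fun _ hS => hP.exists_extends hQP hS

/-- Connectivity is read off a good tree, and one exists by growing from the single vertex `u`. -/
theorem Cut.insert_vertex (hP : Cut x y P) {u v : V} (hu : u ∈ P) (huv : Adj x y v u) :
    Cut x y (insert v P) := by
  by_cases hv : v ∈ P
  · rwa [Finset.insert_eq_of_mem hv]
  obtain ⟨S, hS, -⟩ := hP.exists_extends (Finset.singleton_subset_iff.mpr hu)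
    (good_singleton (x := x) (y := y) u)
  obtain ⟨e, -, h⟩ := exists_attach hv hu huv
  exact (h S hS).cut

/-- The left and the right attachments of `v` are both available and use different edges. -/
theorem count_insert_of_mixed [Finite V] {a b v : V} (hv : v ∉ P) (ha : a ∈ P) (hb : b ∈ P)
    (hav : Inv x y a v) (hvb : Inv x y v b) : 2 * count x y P ≤ count x y (insert v P) := by
  obtain ⟨w, hw, h1, h2⟩ := exists_lowest hb hvb
  obtain ⟨w', hw', h1', h2'⟩ := exists_leftmost ha hav
  refine two_mul_count_le_count fun S hS => ⟨insert (v, w) S, insert (w', v) S,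
    hS.attach_right hv hw h1 h2, hS.attach_left hv hw' h1' h2', hS.extends_insert hv (Or.inl rfl),
    hS.extends_insert hv (Or.inr rfl), fun he => ?_⟩
  have : (v, w) ∈ insert (w', v) S := he ▸ Finset.mem_insert_self _ _
  rw [Finset.mem_insert, Prod.mk.injEq] at this
  rcases this with ⟨rfl, -⟩ | this
  · exact hv hw'
  · exact hv (hS.mem_inv _ _ this).1

theorem exists_good_edge {u v : V} (huv : Adj x y v u) :
    ∃ e : V × V, (e = (v, u) ∨ e = (u, v)) ∧ Good x y {v, u} {e} := by
  have hv : v ∉ ({u} : Finset V) := by simpa using huv.ne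
  rcases huv with huv | huv
  · refine ⟨(v, u), Or.inl rfl, (good_singleton u).attach_right hv (by simp) huv ?_⟩
    simp
  · refine ⟨(u, v), Or.inr rfl, (good_singleton u).attach_left hv (by simp) huv ?_⟩
    simp

/-- Besides the extensions along the fixed edge `e`, there is a tree grown from another edge at `v`;
in the former, `v` is a leaf on `e`, so this one is new. -/
theorem Cut.count_lt_count_insert [Finite V] (hP : Cut x y P) {u w v : V} (hv : v ∉ P)
    (hu : u ∈ P) (hw : w ∈ P) (huw : u ≠ w) (hvu : Adj x y v u) (hvw : Adj x y v w) :
    count x y P + 1 ≤ count x y (insert v P) := by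
  obtain ⟨e, he, hgood⟩ := exists_attach hv hu hvu
  obtain ⟨z, hz, hvz, hze⟩ : ∃ z ∈ P, Adj x y v z ∧ e.1 ≠ z ∧ e.2 ≠ z := by
    by_cases h : e.1 = u ∨ e.2 = u
    · refine ⟨w, hw, hvw, ?_⟩
      have := hvw.ne
      rcases h with h | h <;> rcases he with he | he <;> grind
    · exact ⟨u, hu, hvu, by tauto⟩
  obtain ⟨e', he', hgood'⟩ := exists_good_edge hvz
  obtain ⟨S₀, hS₀, hext⟩ := (hP.insert_vertex hu hvu).exists_extends
    (Q := {v, z}) (by intro a; simp; rintro (rfl | rfl) <;> simp [hz]) hgood'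
  have he'S : e' ∈ S₀ := ((hext e'.1 e'.2).mp (by simp)).1
  have hinj : Set.InjOn (fun S : Finset (V × V) => insert e S) {S | Good x y P S} := by
    intro S₁ h₁ S₂ h₂ h
    have h3 := Good.extends_insert h₁ hv he
    rw [show insert e S₁ = insert e S₂ from h] at h3
    exact h3.unique (Good.extends_insert h₂ hv he)
  have hS₀' : S₀ ∉ (fun S : Finset (V × V) => insert e S) '' {S | Good x y P S} := by
    rintro ⟨S, hS, rfl⟩
    rcases Finset.mem_insert.mp he'S with h | h
    · subst h
      rcases he' with rfl | rfl
      · exact hze.2 rfl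
      · exact hze.1 rfl
    · have := Good.mem_inv hS e'.1 e'.2 h
      rcases he' with rfl | rfl
      · exact hv this.1
      · exact hv this.2.1
  rw [count, ← hinj.ncard_image, ← Set.ncard_insert_of_notMem hS₀' (Set.toFinite _)]
  refine Set.ncard_le_ncard ?_ (Set.toFinite _)
  rintro _ (rfl | ⟨S, hS, rfl⟩)
  · exact hS₀
  · exact hgood S hS

/-- The only edge of the tree at `v` is `e`, so `v` is a leaf and can be pruned. -/
theorem Good.erase {v : V} (h : Good x y (insert v P) S) {u : V} (hv : v ∉ P) (hu : u ∈ P) {e : V × V}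
    (he : e = (v, u) ∨ e = (u, v)) (hev : ∀ a b, (a, b) ∈ S → a = v ∨ b = v → (a, b) = e) :
    e ∈ S ∧ Good x y P (S.erase e) := by
  have hvu : v ≠ u := fun h => hv (h ▸ hu)
  have heS : e ∈ S := by
    obtain ⟨a, b, hab, h1⟩ := h.conn {v} (by simp) (by simp) (by
      intro h1
      have : u ∈ ({v} : Finset V) := h1 ▸ (by simp [hu])
      exact hvu (Finset.mem_singleton.mp this).symm)
    rw [← hev a b hab (by simp only [Finset.mem_singleton] at h1; tauto)]
    exact hab
  have hne : ∀ a b, (a, b) ∈ S.erase e → a ≠ v ∧ b ≠ v := by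
    intro a b hab
    rw [Finset.mem_erase] at hab
    exact ⟨fun h1 => hab.1 (hev a b hab.2 (Or.inl h1)), fun h1 => hab.1 (hev a b hab.2 (Or.inr h1))⟩
  refine ⟨heS, ?_, ?_, ?_, ?_, ?_⟩
  · intro a b hab
    obtain ⟨h1, h2, h3⟩ := h.mem_inv a b (Finset.mem_of_mem_erase hab)
    obtain ⟨h4, h5⟩ := hne a b hab
    exact ⟨(Finset.mem_insert.mp h1).resolve_left h4, (Finset.mem_insert.mp h2).resolve_left h5, h3⟩
  · intro a b c hab hbc
    exact h.pure a b c (Finset.mem_of_mem_erase hab) (Finset.mem_of_mem_erase hbc)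
  · intro a a' b b' h1 h2 h3
    exact h.corner a a' b b' (Finset.mem_of_mem_erase h1) (Finset.mem_of_mem_erase h2)
      (Finset.mem_of_mem_erase h3)
  · intro A hA hAne hAP
    have hvA : v ∉ A := fun h1 => hv (hA h1)
    -- `B` is `A`, possibly with `v` added, chosen so that `u` and `v` lie on the same side; the
    -- crossing edge is then not `e`.
    have key : ∀ B : Finset V, B ⊆ insert v P → B.Nonempty → B ≠ insert v P →
        (u ∈ B ↔ v ∈ B) → (∀ c, c ≠ v → (c ∈ B ↔ c ∈ A)) →
        ∃ a b, (a, b) ∈ S.erase e ∧ (a ∈ A ∧ b ∉ A ∨ a ∉ A ∧ b ∈ A) := by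
      intro B hB hBne hBP huv hBA
      obtain ⟨a, b, hab, h1⟩ := h.conn B hB hBne hBP
      have hmem : (a, b) ∈ S.erase e := by
        rw [Finset.mem_erase]
        refine ⟨?_, hab⟩
        rintro rfl
        rw [Prod.mk.injEq, Prod.mk.injEq] at he
        rcases he with ⟨rfl, rfl⟩ | ⟨rfl, rfl⟩ <;> tauto
      refine ⟨a, b, hmem, ?_⟩
      obtain ⟨h4, h5⟩ := hne a b hmem
      rwa [hBA a h4, hBA b h5] at h1
    by_cases huA : u ∈ A
    · refine key (insert v A) (Finset.insert_subset_insert _ hA) (by simp) ?_ (by simp [huA])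
        (by simp +contextual)
      intro h1
      apply hAP
      rw [← Finset.erase_insert hvA, h1, Finset.erase_insert hv]
    · refine key A (hA.trans (Finset.subset_insert _ _)) hAne ?_ (by simp [huA, hvA]) (by simp)
      rintro rfl
      simp at hvA
  · have h1 := h.card
    rw [Finset.card_insert_of_notMem hv] at h1
    have h2 := Finset.card_erase_add_one heS
    omega

/-- Every good tree must use the only edge at `v`, so pruning `v` is injective. -/
theorem count_insert_le [Finite V] {u v : V} (hv : v ∉ P) (hu : u ∈ P) (hvu : Adj x y v u)
    (huniq : ∀ w ∈ P, Adj x y v w → w = u) : count x y (insert v P) ≤ count x y P := by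
  obtain ⟨e, he, hev⟩ : ∃ e : V × V, (e = (v, u) ∨ e = (u, v)) ∧
      ∀ S, Good x y (insert v P) S → ∀ a b, (a, b) ∈ S → a = v ∨ b = v → (a, b) = e := by
    have hmem : ∀ S, Good x y (insert v P) S → ∀ a b, (a, b) ∈ S → a = v ∨ b = v →
        Inv x y a b ∧ (a = v ∧ b = u ∨ a = u ∧ b = v) := by
      intro S hS a b hab h1
      obtain ⟨ha, hb, hi⟩ := hS.mem_inv a b hab
      refine ⟨hi, ?_⟩
      rcases h1 with rfl | rfl
      · exact Or.inl ⟨rfl, huniq b ((Finset.mem_insert.mp hb).resolve_left hi.ne.symm) (Or.inl hi)⟩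
      · exact Or.inr ⟨huniq a ((Finset.mem_insert.mp ha).resolve_left hi.ne) (Or.inr hi), rfl⟩
    rcases hvu with hvu | hvu
    · refine ⟨(v, u), Or.inl rfl, fun S hS a b hab h1 => ?_⟩
      obtain ⟨hi, ⟨rfl, rfl⟩ | ⟨rfl, rfl⟩⟩ := hmem S hS a b hab h1
      · rfl
      · exact (hi.asymm hvu).elim
    · refine ⟨(u, v), Or.inr rfl, fun S hS a b hab h1 => ?_⟩
      obtain ⟨hi, ⟨rfl, rfl⟩ | ⟨rfl, rfl⟩⟩ := hmem S hS a b hab h1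
      · exact (hi.asymm hvu).elim
      · rfl
  refine Set.ncard_le_ncard_of_injOn (fun S => S.erase e)
    (fun S hS => (Good.erase hS hv hu he (hev S hS)).2) ?_ (Set.toFinite _)
  intro S₁ h₁ S₂ h₂ h
  rw [← Finset.insert_erase (Good.erase h₁ hv hu he (hev S₁ h₁)).1,
    ← Finset.insert_erase (Good.erase h₂ hv hu he (hev S₂ h₂)).1]
  exact congrArg _ h

/-- Either the number of good trees does not grow from `B` to `R`, or some vertex closes a cycle on
the way. -/
theorem Cut.count_le_or_exists [Finite V] {R : Finset V} (hR : Cut x y R) {B : Finset V}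
    (hBR : B ⊆ R) (hB : Cut x y B) (hne : B.Nonempty) :
    count x y R ≤ count x y B ∨ ∃ P, B ⊆ P ∧ P ⊆ R ∧ Cut x y P ∧ ∃ v ∈ R, v ∉ P ∧
      ∃ u ∈ P, ∃ w ∈ P, u ≠ w ∧ Adj x y v u ∧ Adj x y v w := by
  by_cases hBeq : B = R
  · subst hBeq; exact Or.inl le_rfl
  obtain ⟨v, hvR, hv, u, hu, hvu⟩ := hR.exists_adj hBR hne hBeq
  by_cases h : ∀ w ∈ B, Adj x y v w → w = u
  · have hlt : (R \ insert v B).card < (R \ B).card := by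
      apply Finset.card_lt_card
      refine Finset.ssubset_iff_subset_ne.mpr ⟨Finset.sdiff_subset_sdiff le_rfl (by simp), ?_⟩
      intro h1
      have : v ∈ R \ insert v B := h1 ▸ (by simp [hvR, hv])
      simp at this
    rcases Cut.count_le_or_exists hR (Finset.insert_subset hvR hBR) (hB.insert_vertex hu hvu)
      (by simp) with h1 | ⟨P, h1, h2⟩
    · exact Or.inl (h1.trans (count_insert_le hv hu hvu h))
    · exact Or.inr ⟨P, (Finset.subset_insert _ _).trans h1, h2⟩
  · push Not at h
    obtain ⟨w, hw, hvw, hwu⟩ := h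
    exact Or.inr ⟨B, le_rfl, hBR, hB, v, hvR, hv, u, hu, w, hw, hwu.symm, hvu, hvw⟩
termination_by (R \ B).card

/-- A further subgraph of minimum degree two forces some vertex to close a cycle. -/
theorem Cut.exists_of_not_subset {R : Finset V} (hR : Cut x y R) {B D : Finset V}
    (hBR : B ⊆ R) (hB : Cut x y B) (hne : B.Nonempty) (hDR : D ⊆ R) (hDB : ¬ D ⊆ B)
    (hD : ∀ v ∈ D, ∃ u ∈ D, ∃ w ∈ D, u ≠ w ∧ Adj x y v u ∧ Adj x y v w) :
    ∃ P, B ⊆ P ∧ P ⊆ R ∧ Cut x y P ∧ ∃ v ∈ R, v ∉ P ∧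
      ∃ u ∈ P, ∃ w ∈ P, u ≠ w ∧ Adj x y v u ∧ Adj x y v w := by
  obtain ⟨v, hvR, hv, u, hu, hvu⟩ := hR.exists_adj hBR hne (by rintro rfl; exact hDB hDR)
  by_cases h : D ⊆ insert v B
  · have hvD : v ∈ D := by
      by_contra h1
      exact hDB ((Finset.subset_insert_iff_of_notMem h1).mp h)
    obtain ⟨a, ha, b, hb, hab, h1, h2⟩ := hD v hvD
    exact ⟨B, le_rfl, hBR, hB, v, hvR, hv, a, (Finset.mem_insert.mp (h ha)).resolve_left h1.ne.symm,
      b, (Finset.mem_insert.mp (h hb)).resolve_left h2.ne.symm, hab, h1, h2⟩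
  · have hlt : (R \ insert v B).card < (R \ B).card := by
      apply Finset.card_lt_card
      refine Finset.ssubset_iff_subset_ne.mpr ⟨Finset.sdiff_subset_sdiff le_rfl (by simp), ?_⟩
      intro h1
      have : v ∈ R \ insert v B := h1 ▸ (by simp [hvR, hv])
      simp at this
    obtain ⟨P, h1, h2⟩ := Cut.exists_of_not_subset hR (Finset.insert_subset hvR hBR)
      (hB.insert_vertex hu hvu) (by simp) hDR h hD
    exact ⟨P, (Finset.subset_insert _ _).trans h1, h2⟩
termination_by (R \ B).card

end InversionTree

/-! ### Cycles in the inversion graph versus `321` and `3412` -/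

namespace InversionTree

variable {V : Type*} {x y : V → ℕ} {P Q : Finset V}

/-- The vertices `a, b, c, d` form an occurrence of `3412`. -/
def Pat (x y : V → ℕ) (a b c d : V) : Prop :=
  x a < x b ∧ x b < x c ∧ x c < x d ∧ y c < y d ∧ y d < y a ∧ y a < y b

theorem Inv.swap {a b : V} (h : Inv x y a b) : Inv y x b a := ⟨h.2, h.1⟩

theorem Adj.swap {a b : V} (h : Adj x y a b) : Adj y x a b := h.symm.imp Inv.swap Inv.swap

theorem Cut.swap (h : Cut x y P) : Cut y x P := by
  intro A hA hne hAP
  obtain ⟨a, ha, b, hb, hbA, hab⟩ := h A hA hne hAP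
  exact ⟨a, ha, b, hb, hbA, hab.swap⟩

theorem Pat.swap {a b c d : V} (h : Pat x y a b c d) : Pat y x c d a b := by
  obtain ⟨h1, h2, h3, h4, h5, h6⟩ := h
  exact ⟨h4, h5, h6, h1, h2, h3⟩

/-- Without triangles at `v`, its neighbours in `P` all lie to its left and increase in height; let
`m` be the last. An edge must leave the set formed by `m` and the vertices to the upper right of
`v`. Its outer end is another neighbour of `v` or a vertex to the lower left of `v`, and either case
completes a `3412`. -/
theorem Cut.exists_pat_of_left (hx : x.Injective) (hy : y.Injective) (hP : Cut x y P) {u w v : V}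
    (hv : v ∉ P) (hu : u ∈ P) (hw : w ∈ P) (huw : u ≠ w) (huv : Inv x y u v) (hwv : Inv x y w v)
    (htri : ∀ a ∈ P, ∀ b ∈ P, Adj x y v a → Adj x y v b → ¬ Adj x y a b) :
    ∃ a b c d, Pat x y a b c d ∧ (v = c ∨ v = d) := by
  classical
  have hlt : ∀ a b, a ≠ b → ¬ Adj x y a b → x a < x b → y a < y b := by
    intro a b hab hadj h
    have h1 := hy.ne hab
    by_contra h2
    exact hadj (Or.inl ⟨h, by omega⟩)
  have hleft : ∀ z ∈ P, Adj x y v z → Inv x y z v := by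
    rintro z hz (h | h)
    · exact absurd (Or.inl (huv.trans h)) (htri u hu z hz (Or.inr huv) (Or.inl h))
    · exact h
  obtain ⟨m, hm, hmax⟩ := Finset.exists_max_image (P.filter (Inv x y · v)) x ⟨u, by simp [hu, huv]⟩
  rw [Finset.mem_filter] at hm
  obtain ⟨hmP, hmv⟩ := hm
  have hmlt : ∀ z ∈ P, Inv x y z v → z ≠ m → x z < x m ∧ y z < y m := by
    intro z hz hzv hzm
    have h1 := hmax z (by simp [hz, hzv])
    have h2 := hx.ne hzm
    have h3 : x z < x m := by omega
    exact ⟨h3, hlt z m hzm (htri z hz m hmP (Or.inr hzv) (Or.inr hmv)) h3⟩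
  obtain ⟨p, hp, hpv, hpm⟩ : ∃ p ∈ P, Inv x y p v ∧ p ≠ m := by
    by_cases h : u = m
    · exact ⟨w, hw, hwv, by rintro rfl; exact huw h⟩
    · exact ⟨u, hu, huv, h⟩
  obtain ⟨a, ha, b, hb, hbA, hab⟩ := hP (P.filter (fun z => z = m ∨ (x v < x z ∧ y v < y z)))
    (Finset.filter_subset _ _) ⟨m, by simp [hmP]⟩ (by
      intro h
      have h1 : p ∈ P.filter (fun z => z = m ∨ (x v < x z ∧ y v < y z)) := by rw [h]; exact hp
      rw [Finset.mem_filter] at h1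
      rcases h1.2 with h2 | h2
      · exact hpm h2
      · have := hpv.1; omega)
  rw [Finset.mem_filter] at ha hbA
  have hbm : b ≠ m := fun h => hbA ⟨hb, Or.inl h⟩
  have hbv : b ≠ v := fun h => hv (h ▸ hb)
  have hbcases : Inv x y b v ∨ (x b < x v ∧ y b < y v) := by
    by_cases h : Adj x y v b
    · exact Or.inl (hleft b hb h)
    · right
      have h1 : ¬ (x v < x b ∧ y v < y b) := fun h1 => hbA ⟨hb, Or.inr h1⟩
      have h2 := hx.ne hbv
      have h3 := hy.ne hbv
      unfold Adj Inv at h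
      omega
  obtain ⟨hpm1, hpm2⟩ := hmlt p hp hpv hpm
  unfold Inv at hpv hmv
  unfold Adj Inv at hab
  unfold Pat
  rcases hbcases with hbv' | hbv'
  · obtain ⟨h1, h2⟩ := hmlt b hb hbv' hbm
    rcases ha.2 with rfl | ha'
    · exact absurd hab (htri a hmP b hb (Or.inr hmv) (Or.inr hbv'))
    · unfold Inv at hbv'
      exact ⟨b, m, v, a, by omega, by simp⟩
  · rcases ha.2 with rfl | ha'
    · exact ⟨p, a, b, v, by omega, by simp⟩
    · omega

/-- A vertex with two neighbours in a connected set lies in an occurrence of `321` or of `3412`. -/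
theorem Cut.triangle_or_pat (hx : x.Injective) (hy : y.Injective) (hP : Cut x y P) {u w v : V}
    (hv : v ∉ P) (hu : u ∈ P) (hw : w ∈ P) (huw : u ≠ w) (hvu : Adj x y v u) (hvw : Adj x y v w) :
    (∃ a ∈ P, ∃ b ∈ P, Adj x y v a ∧ Adj x y v b ∧ Adj x y a b) ∨
      ∃ a b c d, Pat x y a b c d ∧ (v = a ∨ v = b ∨ v = c ∨ v = d) := by
  by_cases htri : ∃ a ∈ P, ∃ b ∈ P, Adj x y v a ∧ Adj x y v b ∧ Adj x y a b
  · exact Or.inl htri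
  right
  push Not at htri
  -- Neighbours on opposite sides of `v` are adjacent by transitivity. Two right neighbours become
  -- two left ones when positions and values are exchanged, which preserves `3412`.
  rcases hvu with hvu | hvu <;> rcases hvw with hvw | hvw
  · obtain ⟨a, b, c, d, h1, h2⟩ := hP.swap.exists_pat_of_left hy hx hv hu hw huw hvu.swap hvw.swap
      (fun a ha b hb h1 h2 h3 => htri a ha b hb h1.swap h2.swap h3.swap)
    exact ⟨c, d, a, b, h1.swap, by tauto⟩
  · exact absurd (Or.inr (hvw.trans hvu)) (htri u hu w hw (Or.inl hvu) (Or.inr hvw))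
  · exact absurd (Or.inl (hvu.trans hvw)) (htri u hu w hw (Or.inr hvu) (Or.inl hvw))
  · obtain ⟨a, b, c, d, h1, h2⟩ := hP.exists_pat_of_left hx hy hv hu hw huw hvu hvw htri
    exact ⟨a, b, c, d, h1, by tauto⟩

variable [DecidableEq V]

/-- Each tree omits one edge of the four-cycle; omitting `(i, k)` instead would violate `corner` at
`(j, l)`. Only `x i < x j` and `y k < y l` are assumed within the pairs, so that `four_le_count` can
allow an extra inversion there. -/
theorem good_three {i j k l : V} (hik : Inv x y i k) (hil : Inv x y i l) (hjk : Inv x y j k)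
    (hjl : Inv x y j l) (hij : x i < x j) (hkl : y k < y l) :
    Good x y {i, j, k, l} {(i, k), (i, l), (j, k)} ∧ Good x y {i, j, k, l} {(i, k), (i, l), (j, l)} ∧
      Good x y {i, j, k, l} {(i, k), (j, k), (j, l)} := by
  have nij : i ≠ j := by rintro rfl; omega
  have nkl : k ≠ l := by rintro rfl; omega
  have nik := hik.ne
  have nil := hil.ne
  have njk := hjk.ne
  have njl := hjl.ne
  refine ⟨?_, ?_, ?_⟩
  · have h1 : Good x y {i, k} {(i, k)} := by
      simpa [Finset.pair_comm] using (good_singleton i).attach_left (v := k) (u := i)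
        (by simp [nik.symm]) (by simp) hik (by simp)
    have h2 := h1.attach_left (v := l) (u := i) (by simp [nil.symm, nkl.symm]) (by simp) hil (by
      have := hik.1; simp; omega)
    have h3 := h2.attach_right (v := j) (u := k) (by simp [nij.symm, njk, njl]) (by simp) hjk (by
      have := hjk.2
      have := hil.2
      simp [Inv]; omega)
    convert h3 using 1 <;> (ext a; simp; tauto)
  · have h1 : Good x y {j, l} {(j, l)} := by
      simpa [Finset.pair_comm] using (good_singleton j).attach_left (v := l) (u := j)
        (by simp [njl.symm]) (by simp) hjl (by simp)
    have h2 := h1.attach_right (v := i) (u := l) (by simp [nil, nij]) (by simp) hil (by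
      have := hjl.2; simp; omega)
    have h3 := h2.attach_left (v := k) (u := i) (by simp [nik.symm, njk.symm, nkl]) (by simp) hik (by
      have := hil.1
      simp [Inv]; omega)
    convert h3 using 1
    ext a; simp; tauto
  · have h1 : Good x y {j, l} {(j, l)} := by
      simpa [Finset.pair_comm] using (good_singleton j).attach_left (v := l) (u := j)
        (by simp [njl.symm]) (by simp) hjl (by simp)
    have h2 := h1.attach_left (v := k) (u := j) (by simp [njk.symm, nkl]) (by simp) hjk (by
      have := hjl.1; simp; omega)
    have h3 := h2.attach_right (v := i) (u := k) (by simp [nik, nij, nil]) (by simp) hik (by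
      have := hjk.2
      simp [Inv]; omega)
    convert h3 using 1
    ext a; simp; tauto

end InversionTree

/-! ### Counts for triangles, four-cycles and pairs of triangles -/

namespace InversionTree

variable {V : Type*} {x y : V → ℕ} {P Q R : Finset V}

/-- If `i` or `k` has neighbours in `P` on both sides, it doubles the count alone. Otherwise attach
`i` and `k` in either order: the two results differ unless `a, i, b, k` form a `3412`, where `b` is
the lowest right neighbour of `i` and `a` the leftmost left neighbour of `k` in `P`. -/
theorem two_mul_count_insert_insert [DecidableEq V] [Finite V] (hx : x.Injective) (hy : y.Injective)
    (hno : ∀ a b c d, ¬ Pat x y a b c d) {i j k : V} (hij : Inv x y i j) (hjk : Inv x y j k)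
    (hi : i ∉ P) (hj : j ∈ P) (hk : k ∉ P) :
    2 * count x y P ≤ count x y (insert i (insert k P)) := by
  have hik := hij.trans hjk
  have hi' : i ∉ insert k P := by simp [hi, hik.ne]
  have hk' : k ∉ insert i P := by simp [hk, hik.ne.symm]
  have hmono : ∀ {Q : Finset V} {u v : V}, v ∉ Q → u ∈ Q → Adj x y v u →
      count x y Q ≤ count x y (insert v Q) := by
    intro Q u v hv hu huv
    obtain ⟨e, he, h⟩ := exists_attach hv hu huv
    exact count_le_count fun S hS => ⟨_, h S hS, hS.extends_insert hv he⟩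
  by_cases h1 : ∃ a ∈ P, Inv x y a i
  · obtain ⟨a, ha, hai⟩ := h1
    rw [Finset.insert_comm]
    exact (count_insert_of_mixed hi ha hj hai hij).trans
      (hmono hk' (u := j) (by simp [hj]) (Or.inr hjk))
  by_cases h2 : ∃ b ∈ P, Inv x y k b
  · obtain ⟨b, hb, hkb⟩ := h2
    exact (count_insert_of_mixed hk hj hb hjk hkb).trans
      (hmono hi' (u := j) (by simp [hj]) (Or.inl hij))
  push Not at h1 h2
  obtain ⟨b, hb, hib, hbmin⟩ := exists_lowest hj hij
  obtain ⟨a, ha, hak, hamin⟩ := exists_leftmost hj hjk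
  have hai : a ≠ i := by rintro rfl; exact hi ha
  have hbk : b ≠ k := by rintro rfl; exact hk hb
  have hor : x i < x a ∨ y k < y b := by
    by_contra! h
    refine hno a i b k ?_
    have e1 := h1 a ha
    have e2 := h2 b hb
    have e3 := hx.ne hai
    have e4 := hy.ne hai
    have e5 := hx.ne hbk
    have e6 := hy.ne hbk
    unfold Inv at e1 e2 hib hak
    unfold Pat
    omega
  refine two_mul_count_le_count fun S hS => ?_
  have hSi := hS.attach_right hi hb hib hbmin
  have hSk := hS.attach_left hk ha hak hamin
  have hei := hS.extends_insert hi (e := (i, b)) (Or.inl rfl)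
  have hek := hS.extends_insert hk (e := (a, k)) (Or.inr rfl)
  have haS : (a, k) ∉ S := fun h => hk (hS.mem_inv _ _ h).2.1
  have hbS : (i, b) ∉ S := fun h => hi (hS.mem_inv _ _ h).1
  -- If `i` precedes `a`, attaching `k` after `i` uses `(i, k)` instead of `(a, k)`; if `k` is lower
  -- than `b`, attaching `i` after `k` uses `(i, k)` instead of `(i, b)`.
  rcases hor with h | h
  · have hT := hSi.attach_left hk' (u := i) (by simp) hik (by
      intro w hw hwk
      rcases Finset.mem_insert.mp hw with rfl | hw
      · exact le_rfl
      · exact h.le.trans (hamin w hw hwk))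
    obtain ⟨w, hw, hiw, hwmin⟩ := exists_lowest (P := insert k P) (by simp) hik
    have hT' := hSk.attach_right hi' hw hiw hwmin
    refine ⟨_, _, by rwa [Finset.insert_comm] at hT, hT',
      hei.trans (hSi.extends_insert hk' (Or.inr rfl)) (by simp),
      hek.trans (hSk.extends_insert hi' (Or.inl rfl)) (by simp), fun he => ?_⟩
    have hmem : (a, k) ∈ insert (i, k) (insert (i, b) S) := he ▸ by simp
    simp [hai, haS] at hmem
  · have hT := hSk.attach_right hi' (u := k) (by simp) hik (by
      intro w hw hwk
      rcases Finset.mem_insert.mp hw with rfl | hw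
      · exact le_rfl
      · exact h.le.trans (hbmin w hw hwk))
    obtain ⟨w, hw, hwk, hwmin⟩ := exists_leftmost (P := insert i P) (by simp) hik
    have hT' := hSi.attach_left hk' hw hwk hwmin
    refine ⟨_, _, hT, by rwa [Finset.insert_comm] at hT',
      hek.trans (hSk.extends_insert hi' (Or.inl rfl)) (by simp),
      hei.trans (hSi.extends_insert hk' (Or.inr rfl)) (by simp), fun he => ?_⟩
    have hmem : (i, b) ∈ insert (i, k) (insert (a, k) S) := he ▸ by simp
    simp [hbk, hbS] at hmem

theorem one_le_count [Finite V] {S : Finset (V × V)} (h : Good x y P S) : 1 ≤ count x y P := by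
  exact (Set.ncard_pos (Set.toFinite _)).mpr ⟨S, h⟩

theorem nonempty_of_count_pos (h : 0 < count x y P) : P.Nonempty ∧ Cut x y P := by
  obtain ⟨S, hS⟩ := Set.nonempty_of_ncard_ne_zero h.ne'
  exact ⟨Good.nonempty hS, Good.cut hS⟩

theorem count_le_one_of_singleton (v : V) : count x y {v} ≤ 1 := by
  have h : {S | Good x y {v} S} ⊆ {∅} := fun S hS => by
    have := Good.card hS
    simpa using this
  exact (Set.ncard_le_ncard h (Set.finite_singleton _)).trans (Set.ncard_singleton _).le

/-- Inversion is transitive and asymmetric, so a triangle cannot be cyclically oriented and is a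
`321`. -/
theorem exists_chain [DecidableEq V] {a b c : V} (hab : Adj x y a b) (hbc : Adj x y b c) (hac : Adj x y a c) :
    ∃ i j k, Inv x y i j ∧ Inv x y j k ∧ ({a, b, c} : Finset V) = {i, j, k} := by
  rcases hab with hab | hab <;> rcases hbc with hbc | hbc <;> rcases hac with hac | hac
  · exact ⟨a, b, c, hab, hbc, rfl⟩
  · exact ((hab.trans hbc).asymm hac).elim
  · exact ⟨a, c, b, hac, hbc, by ext; simp; tauto⟩
  · exact ⟨c, a, b, hac, hab, by ext; simp; tauto⟩
  · exact ⟨b, a, c, hab, hac, by ext; simp; tauto⟩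
  · exact ⟨b, c, a, hbc, hac, by ext; simp; tauto⟩
  · exact ((hbc.trans hab).asymm hac).elim
  · exact ⟨c, b, a, hbc, hab, by ext; simp; tauto⟩

variable [DecidableEq V] [Finite V]

theorem three_le_count {i j k l : V} (hik : Inv x y i k) (hil : Inv x y i l) (hjk : Inv x y j k)
    (hjl : Inv x y j l) (hij : x i < x j) (hkl : y k < y l) : 3 ≤ count x y {i, j, k, l} := by
  obtain ⟨h1, h2, h3⟩ := good_three hik hil hjk hjl hij hkl
  have nij : i ≠ j := by rintro rfl; omega
  have nkl : k ≠ l := by rintro rfl; omega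
  have h : ({{(i, k), (i, l), (j, k)}, {(i, k), (i, l), (j, l)}, {(i, k), (j, k), (j, l)}} :
      Set (Finset (V × V))).ncard = 3 := by
    rw [Set.ncard_eq_three]
    refine ⟨_, _, _, fun h => ?_, fun h => ?_, fun h => ?_, rfl⟩
    · have := Finset.ext_iff.mp h (j, k)
      simp [nij.symm, nkl] at this
    · have := Finset.ext_iff.mp h (i, l)
      simp [nij, nkl.symm] at this
    · have := Finset.ext_iff.mp h (i, l)
      simp [nij, nkl.symm] at this
  rw [← h]
  refine Set.ncard_le_ncard ?_ (Set.toFinite _)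
  rintro _ (rfl | rfl | rfl)
  · exact h1
  · exact h2
  · exact h3

theorem four_le_count {i j k l : V} (hik : Inv x y i k) (hil : Inv x y i l) (hjk : Inv x y j k)
    (hjl : Inv x y j l) (hij : x i < x j) (hkl : y k < y l) (h : Inv x y i j ∨ Inv x y l k) :
    4 ≤ count x y {i, j, k, l} := by
  obtain ⟨h1, h2, h3⟩ := good_three hik hil hjk hjl hij hkl
  have nij : i ≠ j := by rintro rfl; omega
  have nkl : k ≠ l := by rintro rfl; omega
  have nik := hik.ne
  have nil := hil.ne
  have njk := hjk.ne
  have njl := hjl.ne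
  -- The fourth tree is a star through the extra inversion: all edges leave `i`, or all edges enter
  -- `k`.
  obtain ⟨e, S, h4, heS, he1, he2⟩ : ∃ (e : V × V) (S : Finset (V × V)),
      Good x y {i, j, k, l} S ∧ e ∈ S ∧
      (e = (i, j) ∨ e = (l, k)) ∧ e ∉ ({(i, k), (i, l), (j, k), (j, l)} : Finset (V × V)) := by
    have hG : Good x y {i, k} {(i, k)} := by
      simpa [Finset.pair_comm] using (good_singleton i).attach_left (v := k) (u := i)
        (by simp [nik.symm]) (by simp) hik (by simp)
    rcases h with h | h
    · have hG2 := hG.attach_left (v := l) (u := i) (by simp [nil.symm, nkl.symm]) (by simp) hil (by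
        have := hik.1; simp; omega)
      have hG3 := hG2.attach_left (v := j) (u := i) (by simp [nij.symm, njk, njl]) (by simp) h (by
        have := hik.1
        have := hil.1
        simp; omega)
      refine ⟨(i, j), insert (i, j) (insert (i, l) {(i, k)}), ?_, by simp, by simp,
        by simp [njk, njl, nij]⟩
      convert hG3 using 1
      ext a; simp; tauto
    · have hG2 := hG.attach_right (v := j) (u := k) (by simp [nij.symm, njk]) (by simp) hjk (by
        have := hik.2; simp [Inv]; omega)
      have hG3 := hG2.attach_right (v := l) (u := k) (by simp [nil.symm, njl.symm, nkl.symm])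
        (by simp) h (by
        have := hjk.2
        have := hik.2
        simp; omega)
      refine ⟨(l, k), insert (l, k) (insert (j, k) {(i, k)}), ?_, by simp, by simp,
        by simp [njl.symm, nil.symm]⟩
      convert hG3 using 1
      ext a; simp; tauto
  simp only [Finset.mem_insert, Finset.mem_singleton, not_or] at he2
  have h : ({S, {(i, k), (i, l), (j, k)}, {(i, k), (i, l), (j, l)}, {(i, k), (j, k), (j, l)}} :
      Set (Finset (V × V))).ncard = 4 := by
    rw [Set.ncard_insert_of_notMem _ (Set.toFinite _)]
    · refine congrArg (· + 1) (Set.ncard_eq_three.mpr ?_)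
      refine ⟨_, _, _, fun h => ?_, fun h => ?_, fun h => ?_, rfl⟩
      · have := Finset.ext_iff.mp h (j, k)
        simp [nij.symm, nkl] at this
      · have := Finset.ext_iff.mp h (i, l)
        simp [nij, nkl.symm] at this
      · have := Finset.ext_iff.mp h (i, l)
        simp [nij, nkl.symm] at this
    · rintro (rfl | rfl | rfl) <;> simp at heS <;> tauto
  rw [← h]
  refine Set.ncard_le_ncard ?_ (Set.toFinite _)
  rintro _ (rfl | rfl | rfl | rfl)
  · exact h4
  · exact h1
  · exact h2
  · exact h3

/-- The induced graph is a four-cycle, so a spanning tree omits one edge; `corner` forbids omitting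
`(i, k)`. -/
theorem Pat.count_eq {i j k l : V} (h : Pat x y i j k l) : count x y {i, j, k, l} = 3 := by
  obtain ⟨h1, h2, h3, h4, h5, h6⟩ := h
  have hik : Inv x y i k := ⟨by omega, by omega⟩
  have hil : Inv x y i l := ⟨by omega, by omega⟩
  have hjk : Inv x y j k := ⟨by omega, by omega⟩
  have hjl : Inv x y j l := ⟨by omega, by omega⟩
  refine le_antisymm ?_ (three_le_count hik hil hjk hjl h1 h4)
  have nij : i ≠ j := by rintro rfl; omega
  have nkl : k ≠ l := by rintro rfl; omega
  have nik := hik.ne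
  have nil := hil.ne
  have njk := hjk.ne
  have njl := hjl.ne
  set E : Finset (V × V) := {(i, k), (i, l), (j, k), (j, l)} with hE
  have hEcard : E.card = 4 := by
    rw [hE]; simp [Finset.card_insert_of_notMem, nij, nkl]
  have hsub : {S | Good x y {i, j, k, l} S} ⊆
      (fun e => E.erase e) '' ({(i, l), (j, k), (j, l)} : Set (V × V)) := by
    intro S hS
    have hS : Good x y {i, j, k, l} S := hS
    have hSE : S ⊆ E := by
      rintro ⟨a, b⟩ hab
      obtain ⟨ha, hb, h7, h8⟩ := hS.mem_inv a b hab
      simp only [Finset.mem_insert, Finset.mem_singleton] at ha hb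
      rcases ha with rfl | rfl | rfl | rfl <;> rcases hb with rfl | rfl | rfl | rfl <;>
        first | omega | simp [hE]
    have hScard : S.card = 3 := by
      have := hS.card
      rw [show ({i, j, k, l} : Finset V).card = 4 by
        simp [Finset.card_insert_of_notMem, nij, nkl, nik, nil, njk, njl]] at this
      omega
    obtain ⟨e, he, rfl⟩ : ∃ e ∈ E, E.erase e = S := by
      have : (E \ S).card = 1 := by rw [Finset.card_sdiff_of_subset hSE]; omega
      obtain ⟨e, he⟩ := Finset.card_eq_one.mp this
      have heE : e ∈ E \ S := he ▸ by simp
      refine ⟨e, (Finset.mem_sdiff.mp heE).1, ?_⟩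
      rw [Finset.erase_eq, ← he, Finset.sdiff_sdiff_eq_self hSE]
    refine ⟨e, ?_, rfl⟩
    simp only [hE, Finset.mem_insert, Finset.mem_singleton] at he
    rcases he with rfl | he
    · exact (hS.corner j i l k (by simp [hE, nij.symm]) (by simp [hE, nij.symm])
        (by simp [hE, nkl.symm]) h1 h4).elim
    · simpa using he
  calc count x y {i, j, k, l} ≤ _ := Set.ncard_le_ncard hsub (Set.toFinite _)
    _ ≤ _ := Set.ncard_image_le (Set.toFinite _)
    _ ≤ 3 := by
      rw [Set.ncard_eq_three.mpr ⟨_, _, _, ?_, ?_, ?_, rfl⟩] <;> simp [nij, nkl]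

/-- A spanning tree omits one edge; omitting `(i, k)` would make `j` both a right and a left
endpoint. -/
theorem count_triangle {i j k : V} (hij : Inv x y i j) (hjk : Inv x y j k) :
    count x y {i, j, k} = 2 := by
  have hik := hij.trans hjk
  have nij := hij.ne
  have nik := hik.ne
  have njk := hjk.ne
  apply le_antisymm
  · set E : Finset (V × V) := {(i, k), (i, j), (j, k)} with hE
    have hEcard : E.card = 3 := by
      rw [hE]; simp [Finset.card_insert_of_notMem, nij, njk, njk.symm]
    have hsub : {S | Good x y {i, j, k} S} ⊆
        (fun e => E.erase e) '' ({(i, j), (j, k)} : Set (V × V)) := by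
      intro S hS
      have hS : Good x y {i, j, k} S := hS
      have hSE : S ⊆ E := by
        rintro ⟨a, b⟩ hab
        obtain ⟨ha, hb, h7, h8⟩ := hS.mem_inv a b hab
        simp only [Finset.mem_insert, Finset.mem_singleton] at ha hb
        unfold Inv at hij hjk hik
        rcases ha with rfl | rfl | rfl <;> rcases hb with rfl | rfl | rfl <;>
          first | omega | simp [hE]
      have hScard : S.card = 2 := by
        have := hS.card
        rw [show ({i, j, k} : Finset V).card = 3 by
          simp [Finset.card_insert_of_notMem, nij, nik, njk]] at this
        omega
      obtain ⟨e, he, rfl⟩ : ∃ e ∈ E, E.erase e = S := by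
        have : (E \ S).card = 1 := by rw [Finset.card_sdiff_of_subset hSE]; omega
        obtain ⟨e, he⟩ := Finset.card_eq_one.mp this
        have heE : e ∈ E \ S := he ▸ by simp
        refine ⟨e, (Finset.mem_sdiff.mp heE).1, ?_⟩
        rw [Finset.erase_eq, ← he, Finset.sdiff_sdiff_eq_self hSE]
      refine ⟨e, ?_, rfl⟩
      simp only [hE, Finset.mem_insert, Finset.mem_singleton] at he
      rcases he with rfl | he
      · exact (hS.pure i j k (by simp [hE, njk]) (by simp [hE, nij.symm])).elim
      · simpa using he
    calc count x y {i, j, k} ≤ _ := Set.ncard_le_ncard hsub (Set.toFinite _)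
      _ ≤ _ := Set.ncard_image_le (Set.toFinite _)
      _ ≤ 2 := by
        rw [Set.ncard_pair]; simp [nij]
  · have h1 := one_le_count (exists_good_edge (x := x) (y := y) (Or.inl hik)).choose_spec.2
    have h2 := count_insert_of_mixed (P := {i, k}) (v := j) (by simp [nij.symm, njk]) (by simp)
      (by simp) hij hjk
    rw [Finset.insert_comm] at h2
    omega

theorem count_clique {a b c : V} (hab : Adj x y a b) (hbc : Adj x y b c) (hac : Adj x y a c) :
    count x y {a, b, c} = 2 := by
  obtain ⟨i, j, k, hij, hjk, he⟩ := exists_chain hab hbc hac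
  rw [he, count_triangle hij hjk]

/-- Two triangles sharing an edge. -/
theorem four_le_count_of_diamond (hx : x.Injective) (hy : y.Injective) {p q s t : V}
    (hpq : Inv x y p q) (hsp : Adj x y s p) (hsq : Adj x y s q) (htp : Adj x y t p)
    (htq : Adj x y t q) (hst : s ≠ t) : 4 ≤ count x y {s, t, p, q} := by
  have cases : ∀ z, Adj x y z p → Adj x y z q →
      (Inv x y z p ∧ Inv x y z q) ∨ (Inv x y p z ∧ Inv x y z q) ∨ (Inv x y p z ∧ Inv x y q z) := by
    rintro z (h1 | h1) (h2 | h2)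
    · exact Or.inl ⟨h1, h2⟩
    · exact ((hpq.trans h2).asymm h1).elim
    · exact Or.inr (Or.inl ⟨h1, h2⟩)
    · exact Or.inr (Or.inr ⟨h1, h2⟩)
  have hmixed : ∀ {a b c d u w : V}, d ∉ ({a, b, c} : Finset V) → Adj x y a b → Adj x y b c →
      Adj x y a c → u ∈ ({a, b, c} : Finset V) → w ∈ ({a, b, c} : Finset V) → Inv x y u d →
      Inv x y d w → ({s, t, p, q} : Finset V) = {d, a, b, c} → 4 ≤ count x y {s, t, p, q} := by
    intro a b c d u w hd hab hbc hac hu hw hud hdw he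
    have h1 := count_insert_of_mixed hd hu hw hud hdw
    rw [count_clique hab hbc hac] at h1
    rwa [he]
  have nsp := hsp.ne
  have nsq := hsq.ne
  have ntp := htp.ne
  have ntq := htq.ne
  have npq := hpq.ne
  have hs_mixed : ∀ u w, u ∈ ({t, p, q} : Finset V) → w ∈ ({t, p, q} : Finset V) → Inv x y u s →
      Inv x y s w → 4 ≤ count x y {s, t, p, q} := fun u w hu hw hus hsw =>
    hmixed (by simp [hst, nsp, nsq]) htp (Or.inl hpq) htq hu hw hus hsw rfl
  have ht_mixed : ∀ u w, u ∈ ({s, p, q} : Finset V) → w ∈ ({s, p, q} : Finset V) → Inv x y u t →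
      Inv x y t w → 4 ≤ count x y {s, t, p, q} := fun u w hu hw hus hsw =>
    hmixed (by simp [hst.symm, ntp, ntq]) hsp (Or.inl hpq) hsq hu hw hus hsw
      (Finset.insert_comm _ _ _)
  have hxst := hx.ne hst
  have hyst := hy.ne hst
  -- A vertex between `p` and `q` doubles the two trees of the opposite triangle. If `s` and `t` lie
  -- on opposite sides of the edge, `s`, `p`, `t` form a triangle doubled by `q`. If they lie on the
  -- same side, a four-cycle with the extra inversion `(p, q)` gives four trees.
  rcases cases s hsp hsq with ⟨h1, h2⟩ | ⟨h1, h2⟩ | ⟨h1, h2⟩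
  · rcases cases t htp htq with ⟨h3, h4⟩ | ⟨h3, h4⟩ | ⟨h3, h4⟩
    · rcases lt_or_gt_of_ne hxst with h | h
      · have := four_le_count h2 h1 h4 h3 h hpq.2 (Or.inr hpq)
        rwa [Finset.pair_comm q p] at this
      · have := four_le_count h4 h3 h2 h1 h hpq.2 (Or.inr hpq)
        rwa [Finset.insert_comm, Finset.pair_comm q p] at this
    · exact ht_mixed p q (by simp) (by simp) h3 h4
    · refine hmixed (a := s) (b := p) (c := t) (d := q) (u := p) (w := t)
        (by simp [npq.symm, nsq.symm, ntq.symm]) hsp htp.symm (Or.inl (h1.trans h3)) (by simp)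
        (by simp) hpq h4 ?_
      ext a; simp; tauto
  · exact hs_mixed p q (by simp) (by simp) h1 h2
  · rcases cases t htp htq with ⟨h3, h4⟩ | ⟨h3, h4⟩ | ⟨h3, h4⟩
    · refine hmixed (a := t) (b := p) (c := s) (d := q) (u := p) (w := s)
        (by simp [npq.symm, nsq.symm, ntq.symm]) htp hsp.symm (Or.inl (h3.trans h1)) (by simp)
        (by simp) hpq h2 ?_
      ext a; simp; tauto
    · exact ht_mixed p q (by simp) (by simp) h3 h4
    · rcases lt_or_gt_of_ne hyst with h | h
      · have := four_le_count h1 h3 h2 h4 hpq.1 h (Or.inl hpq)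
        convert this using 2
        ext a; simp; tauto
      · have := four_le_count h3 h1 h4 h2 hpq.1 h (Or.inl hpq)
        convert this using 2
        ext a; simp; tauto

/-- If `Q` contains an end of the chain, attach the other end; `j` then has neighbours on both sides
and doubles the count. If `Q` contains `j`, the two ends together double it. -/
theorem Cut.four_le_count_of_single (hx : x.Injective) (hy : y.Injective)
    (hno : ∀ a b c d, ¬ Pat x y a b c d) (hR : Cut x y R) {i j k : V} (hij : Inv x y i j)
    (hjk : Inv x y j k) (hi : i ∈ R) (hj : j ∈ R) (hk : k ∈ R) (hQ : 2 ≤ count x y Q) (hQR : Q ⊆ R)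
    (h : (i ∈ Q ∧ j ∉ Q ∧ k ∉ Q) ∨ (i ∉ Q ∧ j ∈ Q ∧ k ∉ Q) ∨ (i ∉ Q ∧ j ∉ Q ∧ k ∈ Q)) :
    4 ≤ count x y R := by
  have hik := hij.trans hjk
  have hcut := (nonempty_of_count_pos (by omega : 0 < count x y Q)).2
  rcases h with ⟨h1, h2, h3⟩ | ⟨h1, h2, h3⟩ | ⟨h1, h2, h3⟩
  · have e1 := (hcut.insert_vertex h1 (Or.inr hik)).count_le (Finset.subset_insert k Q)
    have e2 := count_insert_of_mixed (P := insert k Q) (v := j) (by simp [h2, hjk.ne])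
      (by simp [h1]) (by simp) hij hjk
    have e3 := hR.count_le (Finset.insert_subset hj (Finset.insert_subset hk hQR))
    omega
  · have e1 := two_mul_count_insert_insert hx hy hno hij hjk h1 h2 h3
    have e3 := hR.count_le (Finset.insert_subset hi (Finset.insert_subset hk hQR))
    omega
  · have e1 := (hcut.insert_vertex h3 (Or.inl hik)).count_le (Finset.subset_insert i Q)
    have e2 := count_insert_of_mixed (P := insert i Q) (v := j) (by simp [h2, hij.ne.symm])
      (by simp) (by simp [h3]) hij hjk
    have e3 := hR.count_le (Finset.insert_subset hj (Finset.insert_subset hi hQR))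
    omega

/-- Grow `Q` one vertex at a time; at first contact it contains exactly one vertex of the chain. -/
theorem Cut.four_le_count_of_disjoint (hx : x.Injective) (hy : y.Injective)
    (hno : ∀ a b c d, ¬ Pat x y a b c d) (hR : Cut x y R) {i j k : V} (hij : Inv x y i j)
    (hjk : Inv x y j k) (hi : i ∈ R) (hj : j ∈ R) (hk : k ∈ R) {Q : Finset V}
    (hQ : 2 ≤ count x y Q) (hQR : Q ⊆ R) (h : i ∉ Q ∧ j ∉ Q ∧ k ∉ Q) : 4 ≤ count x y R := by
  obtain ⟨hne, hcut⟩ := nonempty_of_count_pos (by omega : 0 < count x y Q)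
  obtain ⟨v, hvR, hv, u, hu, hvu⟩ := hR.exists_adj hQR hne (by rintro rfl; exact h.1 hi)
  have hQ' := hQ.trans ((hcut.insert_vertex hu hvu).count_le (Finset.subset_insert v Q))
  have hQR' := Finset.insert_subset hvR hQR
  have nij := hij.ne
  have njk := hjk.ne
  have nik := (hij.trans hjk).ne
  by_cases h1 : v = i ∨ v = j ∨ v = k
  · refine hR.four_le_count_of_single hx hy hno hij hjk hi hj hk hQ' hQR' ?_
    rcases h1 with rfl | rfl | rfl <;> simp [*, nij.symm, njk.symm, nik.symm]
  · have hlt : (R \ insert v Q).card < (R \ Q).card := by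
      apply Finset.card_lt_card
      refine Finset.ssubset_iff_subset_ne.mpr ⟨Finset.sdiff_subset_sdiff le_rfl (by simp), ?_⟩
      intro h1
      have : v ∈ R \ insert v Q := h1 ▸ (by simp [hvR, hv])
      simp at this
    refine Cut.four_le_count_of_disjoint hx hy hno hR hij hjk hi hj hk hQ' hQR' ?_
    simp only [Finset.mem_insert]
    grind
termination_by (R \ Q).card

/-- Two different triangles in a connected inversion graph without `3412`. -/
theorem Cut.four_le_count_of_triangles (hx : x.Injective) (hy : y.Injective)
    (hno : ∀ a b c d, ¬ Pat x y a b c d) (hR : Cut x y R) {i j k a b c : V} (hij : Inv x y i j)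
    (hjk : Inv x y j k) (hab : Inv x y a b) (hbc : Inv x y b c)
    (hD : ({i, j, k} : Finset V) ⊆ R) (hT : ({a, b, c} : Finset V) ⊆ R)
    (hDT : ¬ ({i, j, k} : Finset V) ⊆ {a, b, c}) : 4 ≤ count x y R := by
  have hik := hij.trans hjk
  have hac := hab.trans hbc
  have hQ := (count_triangle hab hbc).ge
  have hi : i ∈ R := hD (by simp)
  have hj : j ∈ R := hD (by simp)
  have hk : k ∈ R := hD (by simp)
  have hthird : ∀ p ∈ ({a, b, c} : Finset V), ∀ q ∈ ({a, b, c} : Finset V), p ≠ q →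
      ∃ s ∈ ({a, b, c} : Finset V), Adj x y s p ∧ Adj x y s q := by
    unfold Adj
    simp only [Finset.mem_insert, Finset.mem_singleton]
    grind
  have hdia : ∀ p q t, Inv x y p q → Adj x y t p → Adj x y t q → p ∈ ({a, b, c} : Finset V) →
      q ∈ ({a, b, c} : Finset V) → t ∉ ({a, b, c} : Finset V) → t ∈ R → 4 ≤ count x y R := by
    intro p q t hpq htp htq hp hq ht htR
    obtain ⟨s, hs, hsp, hsq⟩ := hthird p hp q hq hpq.ne
    refine (four_le_count_of_diamond hx hy hpq hsp hsq htp htq ?_).trans (hR.count_le ?_)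
    · rintro rfl; exact ht hs
    · simp only [Finset.insert_subset_iff, Finset.singleton_subset_iff]
      exact ⟨hT hs, htR, hT hp, hT hq⟩
  -- Two common vertices give a diamond; one or none reduces to the preceding lemmas; three are
  -- excluded.
  by_cases h1 : i ∈ ({a, b, c} : Finset V) <;> by_cases h2 : j ∈ ({a, b, c} : Finset V) <;>
    by_cases h3 : k ∈ ({a, b, c} : Finset V)
  · exact (hDT (by simp only [Finset.insert_subset_iff, Finset.singleton_subset_iff]; tauto)).elim
  · exact hdia i j k hij (Or.inr hik) (Or.inr hjk) h1 h2 h3 hk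
  · exact hdia i k j hik (Or.inr hij) (Or.inl hjk) h1 h3 h2 hj
  · exact hR.four_le_count_of_single hx hy hno hij hjk hi hj hk hQ hT (by tauto)
  · exact hdia j k i hjk (Or.inl hij) (Or.inl hik) h2 h3 h1 hi
  · exact hR.four_le_count_of_single hx hy hno hij hjk hi hj hk hQ hT (by tauto)
  · exact hR.four_le_count_of_single hx hy hno hij hjk hi hj hk hQ hT (by tauto)
  · exact hR.four_le_count_of_disjoint hx hy hno hij hjk hi hj hk hQ hT ⟨h1, h2, h3⟩

end InversionTree

/-! ### The criterion for exactly three good trees -/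

namespace InversionTree

variable {V : Type*} {x y : V → ℕ} {P Q R : Finset V} [DecidableEq V]

/-- This is the degree condition by which `Cut.exists_of_not_subset` detects a second pattern. -/
theorem Pat.exists_two_adj {i j k l : V} (h : Pat x y i j k l) :
    ∀ v ∈ ({i, j, k, l} : Finset V), ∃ u ∈ ({i, j, k, l} : Finset V),
      ∃ w ∈ ({i, j, k, l} : Finset V), u ≠ w ∧ Adj x y v u ∧ Adj x y v w := by
  obtain ⟨h1, h2, h3, h4, h5, h6⟩ := h
  have hij : i ≠ j := by rintro rfl; omega
  have hkl : k ≠ l := by rintro rfl; omega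
  intro v hv
  simp only [Finset.mem_insert, Finset.mem_singleton] at hv
  rcases hv with rfl | rfl | rfl | rfl
  · exact ⟨k, by simp, l, by simp, hkl, Or.inl ⟨by omega, by omega⟩, Or.inl ⟨by omega, by omega⟩⟩
  · exact ⟨k, by simp, l, by simp, hkl, Or.inl ⟨by omega, by omega⟩, Or.inl ⟨by omega, by omega⟩⟩
  · exact ⟨i, by simp, j, by simp, hij, Or.inr ⟨by omega, by omega⟩, Or.inr ⟨by omega, by omega⟩⟩
  · exact ⟨i, by simp, j, by simp, hij, Or.inr ⟨by omega, by omega⟩, Or.inr ⟨by omega, by omega⟩⟩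

theorem Inv.exists_two_adj {i j k : V} (hij : Inv x y i j) (hjk : Inv x y j k) :
    ∀ v ∈ ({i, j, k} : Finset V), ∃ u ∈ ({i, j, k} : Finset V),
      ∃ w ∈ ({i, j, k} : Finset V), u ≠ w ∧ Adj x y v u ∧ Adj x y v w := by
  have hik := hij.trans hjk
  intro v hv
  simp only [Finset.mem_insert, Finset.mem_singleton] at hv
  rcases hv with rfl | rfl | rfl
  · exact ⟨j, by simp, k, by simp, hjk.ne, Or.inl hij, Or.inl hik⟩
  · exact ⟨i, by simp, k, by simp, hik.ne, Or.inr hij, Or.inl hjk⟩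
  · exact ⟨i, by simp, j, by simp, hij.ne, Or.inr hik, Or.inr hjk⟩

theorem Pat.eq_of_subset {a b c d i j k l : V} (h : Pat x y a b c d) (h' : Pat x y i j k l)
    (hs : ({i, j, k, l} : Finset V) ⊆ {a, b, c, d}) : i = a ∧ j = b ∧ k = c ∧ l = d := by
  obtain ⟨h1, h2, h3, -⟩ := h
  obtain ⟨h4, h5, h6, -⟩ := h'
  simp only [Finset.insert_subset_iff, Finset.singleton_subset_iff, Finset.mem_insert,
    Finset.mem_singleton] at hs
  obtain ⟨hi, hj, hk, hl⟩ := hs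
  rcases hi with rfl | rfl | rfl | rfl <;> rcases hj with rfl | rfl | rfl | rfl <;> try omega
  all_goals rcases hk with rfl | rfl | rfl | rfl <;> try omega
  all_goals rcases hl with rfl | rfl | rfl | rfl <;> try omega
  exact ⟨rfl, rfl, rfl, rfl⟩

/-- A connected inversion graph has exactly three good trees if and only if it contains exactly one
`3412` and no `321`. -/
theorem Cut.count_eq_three_iff [Finite V] (hx : x.Injective) (hy : y.Injective) (hR : Cut x y R)
    (hne : R.Nonempty) (hmem : ∀ v, v ∈ R) :
    count x y R = 3 ↔
      (∃ a b c d, Pat x y a b c d ∧ ∀ a' b' c' d', Pat x y a' b' c' d' →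
        a' = a ∧ b' = b ∧ c' = c ∧ d' = d) ∧ ∀ i j k, Inv x y i j → ¬ Inv x y j k := by
  have hsub : ∀ P : Finset V, P ⊆ R := fun P v _ => hmem v
  have hgrow : ∀ {B : Finset V}, (∃ P, B ⊆ P ∧ P ⊆ R ∧ Cut x y P ∧ ∃ v ∈ R, v ∉ P ∧
      ∃ u ∈ P, ∃ w ∈ P, u ≠ w ∧ Adj x y v u ∧ Adj x y v w) → count x y B + 1 ≤ count x y R := by
    rintro B ⟨P, hBP, -, hP, v, -, hv, u, hu, w, hw, huw, hvu, hvw⟩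
    have h1 := hP.count_le hBP
    have h2 := hP.count_lt_count_insert hv hu hw huw hvu hvw
    have h3 := hR.count_le (hsub (insert v P))
    omega
  by_cases hpat : ∃ a b c d, Pat x y a b c d
  · obtain ⟨a, b, c, d, habcd⟩ := hpat
    have hB := habcd.count_eq
    obtain ⟨hBne, hBcut⟩ := nonempty_of_count_pos (by omega : 0 < count x y {a, b, c, d})
    constructor
    · intro h3
      -- The pattern already accounts for three trees, so a subgraph of minimum degree two reaching
      -- outside it would force a fourth.
      have hD : ∀ D : Finset V, (∀ v ∈ D, ∃ u ∈ D, ∃ w ∈ D, u ≠ w ∧ Adj x y v u ∧ Adj x y v w) →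
          D ⊆ {a, b, c, d} := by
        intro D hD
        by_contra h
        have := hgrow (hR.exists_of_not_subset (hsub _) hBcut hBne (hsub D) h hD)
        omega
      refine ⟨⟨a, b, c, d, habcd, fun a' b' c' d' h' => habcd.eq_of_subset h'
        (hD _ h'.exists_two_adj)⟩, fun i j k hij hjk => ?_⟩
      have hs := hD _ (hij.exists_two_adj hjk)
      obtain ⟨h1, h2, h3, h4, h5, h6⟩ := habcd
      simp only [Finset.insert_subset_iff, Finset.singleton_subset_iff, Finset.mem_insert,
        Finset.mem_singleton] at hs
      obtain ⟨hi, hj, hk⟩ := hs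
      unfold Inv at hij hjk
      -- Within a `3412` each letter is only a left or only a right endpoint of inversions, so none
      -- is the middle of a `321`.
      rcases hj with rfl | rfl | rfl | rfl
      · rcases hi with rfl | rfl | rfl | rfl <;> omega
      · rcases hi with rfl | rfl | rfl | rfl <;> omega
      · rcases hk with rfl | rfl | rfl | rfl <;> omega
      · rcases hk with rfl | rfl | rfl | rfl <;> omega
    · rintro ⟨⟨a', b', c', d', -, huniq⟩, htri⟩
      have h1 := hR.count_le (hsub {a, b, c, d})
      rcases hR.count_le_or_exists (hsub _) hBcut hBne with
        h | ⟨P, hBP, -, hP, v, -, hv, u, hu, w, hw, huw, hvu, hvw⟩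
      · omega
      · exfalso
        rcases hP.triangle_or_pat hx hy hv hu hw huw hvu hvw with
          ⟨p, -, q, -, h2, h3, h4⟩ | ⟨p, q, r, s, h2, h3⟩
        · obtain ⟨i, j, k, hij, hjk, -⟩ := exists_chain h2 h4 h3
          exact htri i j k hij hjk
        · obtain ⟨rfl, rfl, rfl, rfl⟩ := huniq _ _ _ _ habcd
          obtain ⟨rfl, rfl, rfl, rfl⟩ := huniq _ _ _ _ h2
          exact hv (hBP (by simpa using h3))
  · push Not at hpat
    refine iff_of_false (fun h3 => ?_) (fun ⟨⟨a, b, c, d, h, _⟩, _⟩ => hpat a b c d h)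
    -- Without `3412` the count jumps over 3: the next vertex to close a cycle after a first
    -- triangle lies in a second triangle.
    by_cases htri : ∃ i j k, Inv x y i j ∧ Inv x y j k
    · obtain ⟨i, j, k, hij, hjk⟩ := htri
      have hB := count_triangle hij hjk
      obtain ⟨hBne, hBcut⟩ := nonempty_of_count_pos (by omega : 0 < count x y {i, j, k})
      rcases hR.count_le_or_exists (hsub _) hBcut hBne with
        h | ⟨P, hBP, -, hP, v, -, hv, u, hu, w, hw, huw, hvu, hvw⟩
      · omega
      · rcases hP.triangle_or_pat hx hy hv hu hw huw hvu hvw with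
          ⟨p, -, q, -, h2, h3, h4⟩ | ⟨p, q, r, s, h2, -⟩
        · obtain ⟨a, b, c, hab, hbc, he⟩ := exists_chain h2 h4 h3
          have := hR.four_le_count_of_triangles hx hy hpat hab hbc hij hjk (hsub _) (hsub _) (by
            rw [← he]
            intro h
            exact hv (hBP (h (by simp))))
          omega
        · exact hpat p q r s h2
    · push Not at htri
      obtain ⟨z, hz⟩ := hne
      have hB := count_le_one_of_singleton (x := x) (y := y) z
      rcases hR.count_le_or_exists (B := {z}) (hsub _) (good_singleton z).cut (by simp) with
        h | ⟨P, -, -, hP, v, -, hv, u, hu, w, hw, huw, hvu, hvw⟩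
      · omega
      · rcases hP.triangle_or_pat hx hy hv hu hw huw hvu hvw with
          ⟨p, -, q, -, h2, h3, h4⟩ | ⟨p, q, r, s, h2, -⟩
        · obtain ⟨i, j, k, hij, hjk, -⟩ := exists_chain h2 h4 h3
          exact htri i j k hij hjk
        · exact hpat p q r s h2

end InversionTree

/-! ### Permutations, patterns and connectivity -/

namespace CNATPattern

open InversionTree

variable {n : ℕ}

/-- The position of a letter. -/
def pos (i : Fin n) : ℕ := i

/-- The letter at a position. -/
def letter (π : Equiv.Perm (Fin n)) (i : Fin n) : ℕ := π i

theorem pos_injective : (pos (n := n)).Injective := Fin.val_injective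

theorem letter_injective (π : Equiv.Perm (Fin n)) : (letter π).Injective :=
  Fin.val_injective.comp π.injective

theorem inv_iff {π : Equiv.Perm (Fin n)} {a b : Fin n} :
    Inv pos (letter π) a b ↔ a < b ∧ π b < π a := Iff.rfl

/-- Let `A` contain the first position and have no edge leaving it. Across `A` and its complement,
positions and values are then ordered alike. With `m` the first position outside `A`, every letter
before `m` is smaller than every letter from `m` on, so `π` is reducible. -/
theorem cut_univ {π : Equiv.Perm (Fin n)} (hπ : ¬ Reducible π) :
    Cut pos (letter π) Finset.univ := by
  have key : ∀ A : Finset (Fin n), (∀ a ∈ A, ∀ b ∉ A, ¬ Adj pos (letter π) a b) →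
      ∀ z : Fin n, (z : ℕ) = 0 → z ∈ A → ∀ w, w ∉ A → False := by
    intro A hA z hz hzA w hw
    obtain ⟨m, hm, hmin⟩ := Finset.exists_min_image Aᶜ id ⟨w, by simpa using hw⟩
    rw [Finset.mem_compl] at hm
    have hlt : ∀ i, i < m → i ∈ A := by
      intro i hi
      by_contra h
      exact absurd (hmin i (by simpa using h)) (not_le.mpr hi)
    have hcmp : ∀ a ∈ A, ∀ b ∉ A, (a < b ↔ π a < π b) := by
      intro a ha b hb
      have h1 := hA a ha b hb
      have h2 : a ≠ b := by rintro rfl; exact hb ha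
      have h3 := π.injective.ne h2
      unfold Adj at h1
      rw [inv_iff, inv_iff] at h1
      omega
    have hall : ∀ i j, i < m → m ≤ j → π i < π j := by
      intro i j hi hj
      by_cases hjA : j ∈ A
      · have hjm : j ≠ m := by rintro rfl; exact hm hjA
        have h1 := (hcmp i (hlt i hi) m hm).mp hi
        have h2 := hcmp j hjA m hm
        have h3 := π.injective.ne hjm
        omega
      · exact (hcmp i (hlt i hi) j hjA).mp (by omega)
    refine hπ ⟨m, ?_, m.2, ?_⟩
    · by_contra h
      have : z = m := Fin.ext (by omega)
      exact hm (this ▸ hzA)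
    · have hsub : (Finset.Iio m).image π ⊆ Finset.Iio m := by
        intro r hr
        rw [Finset.mem_image] at hr
        obtain ⟨i, hi, rfl⟩ := hr
        rw [Finset.mem_Iio] at hi ⊢
        -- All values up to `π i` occur before position `m`, so there are at most `m` of them.
        have h1 : (Finset.Iic (π i)) ⊆ (Finset.Iio m).image π := by
          intro s hs
          rw [Finset.mem_Iic] at hs
          refine Finset.mem_image.mpr ⟨π.symm s, ?_, by simp⟩
          rw [Finset.mem_Iio]
          by_contra h
          have := hall i (π.symm s) hi (not_lt.mp h)
          rw [Equiv.apply_symm_apply] at this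
          omega
        have h2 := Finset.card_le_card h1
        rw [Finset.card_image_of_injective _ π.injective, Fin.card_Iic, Fin.card_Iio] at h2
        omega
      have heq := Finset.eq_of_subset_of_card_le hsub
        (by rw [Finset.card_image_of_injective _ π.injective])
      have : π '' Set.Iio m = Set.Iio m := by
        rw [← Finset.coe_Iio, ← Finset.coe_image, heq]
      exact this
  intro A _ hne hAP
  by_contra! h
  have hA : ∀ a ∈ A, ∀ b ∉ A, ¬ Adj pos (letter π) a b := fun a ha b hb =>
    h a ha b (Finset.mem_univ b) hb
  obtain ⟨a, ha⟩ := hne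
  obtain ⟨b, hb⟩ : ∃ b, b ∉ A := by
    by_contra! h1
    exact hAP (Finset.eq_univ_of_forall h1)
  let z : Fin n := ⟨0, a.pos⟩
  by_cases hz : z ∈ A
  · exact key A hA z rfl hz b hb
  · refine key Aᶜ (fun c hc d hd hcd => ?_) z rfl (by simpa using hz) a (by simpa using ha)
    exact hA d (by simpa using hd) c (by simpa using hc) hcd.symm

theorem isOccurrence_p3412_iff {π : Equiv.Perm (Fin n)} {f : Fin 4 → Fin n} :
    IsOccurrence p3412 π f ↔ Pat pos (letter π) (f 0) (f 1) (f 2) (f 3) := by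
  have hp : p3412 0 = 2 ∧ p3412 1 = 3 ∧ p3412 2 = 0 ∧ p3412 3 = 1 := by decide
  obtain ⟨p0, p1, p2, p3⟩ := hp
  unfold Pat pos letter
  constructor
  · rintro ⟨hf, h⟩
    refine ⟨hf (by decide), hf (by decide), hf (by decide), (h 2 3).mpr ?_, (h 3 0).mpr ?_,
      (h 0 1).mpr ?_⟩ <;> simp only [p0, p1, p2, p3] <;> decide
  · rintro ⟨h1, h2, h3, h4, h5, h6⟩
    refine ⟨Fin.strictMono_iff_lt_succ.mpr fun i => ?_, fun a b => ?_⟩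
    · fin_cases i
      · exact h1
      · exact h2
      · exact h3
    · simp only [Fin.lt_def]
      fin_cases a <;> fin_cases b <;> simp [p0, p1, p2, p3] <;> omega

theorem avoids_p321_iff {π : Equiv.Perm (Fin n)} :
    Avoids π p321 ↔ ∀ i j k, Inv pos (letter π) i j → ¬ Inv pos (letter π) j k := by
  have hp : p321 0 = 2 ∧ p321 1 = 1 ∧ p321 2 = 0 := by decide
  obtain ⟨p0, p1, p2⟩ := hp
  unfold InversionTree.Inv pos letter
  constructor
  · intro h i j k hij hjk
    refine h ⟨![i, j, k], Fin.strictMono_iff_lt_succ.mpr fun a => ?_, fun a b => ?_⟩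
    · fin_cases a
      · exact hij.1
      · exact hjk.1
    · simp only [Fin.lt_def]
      fin_cases a <;> fin_cases b <;> simp [p0, p1, p2] <;> omega
  · rintro h ⟨f, hf, hπ⟩
    refine h (f 0) (f 1) (f 2) ⟨hf (by decide), (hπ 1 0).mpr ?_⟩ ⟨hf (by decide), (hπ 2 1).mpr ?_⟩
    · rw [p0, p1]; decide
    · rw [p1, p2]; decide

/-! ### Dots versus edges: CNATs as good trees -/

/-- The edges of the inversion graph given by the non-leaf dots. -/
def edges (π : Equiv.Perm (Fin n)) (T : Filling n n) : Finset (Fin n × Fin n) :=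
  Finset.univ.filter fun e => e.1 ≠ e.2 ∧ (e.1, π e.2) ∈ T

/-- The dots given by the edges of the inversion graph, and the leaf dots. -/
def dots (π : Equiv.Perm (Fin n)) (S : Finset (Fin n × Fin n)) : Filling n n :=
  (S ∪ Finset.univ.diag).map (Equiv.prodCongr (Equiv.refl _) π).toEmbedding

theorem mem_edges {π : Equiv.Perm (Fin n)} {T : Filling n n} {a b : Fin n} :
    (a, b) ∈ edges π T ↔ a ≠ b ∧ (a, π b) ∈ T := by simp [edges]

theorem mem_dots {π : Equiv.Perm (Fin n)} {S : Finset (Fin n × Fin n)} {a b : Fin n} :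
    (a, π b) ∈ dots π S ↔ (a, b) ∈ S ∨ a = b := by
  simp [dots]

theorem card_dots {π : Equiv.Perm (Fin n)} {S : Finset (Fin n × Fin n)} (h : ∀ a, (a, a) ∉ S) :
    (dots π S).card = S.card + n := by
  rw [dots, Finset.card_map, Finset.card_union_of_disjoint, Finset.diag_card, Finset.card_fin]
  rw [Finset.disjoint_left]
  rintro ⟨a, b⟩ hab hd
  simp only [Finset.mem_diag, Finset.mem_univ, true_and] at hd
  subst hd
  exact h a hab

-- Each column has exactly one topmost dot.
open Classical in
theorem card_filter_not_hasAbove {T : Filling n n} (h : ∀ c : Fin n, ∃ r : Fin n, (c, r) ∈ T) :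
    (T.filter fun d => ¬ HasAbove T d).card = n := by
  refine Eq.trans ?_ (Finset.card_fin n)
  refine Finset.card_nbij (fun d => d.1) (by simp) ?_ ?_
  · rintro ⟨c, r⟩ h1 ⟨c', r'⟩ h2 rfl
    simp only [Finset.mem_coe, Finset.mem_filter] at h1 h2
    have h3 : ¬ r < r' := fun h3 => h2.2 ⟨r, h3, h1.1⟩
    have h4 : ¬ r' < r := fun h4 => h1.2 ⟨r', h4, h2.1⟩
    rw [le_antisymm (not_lt.mp h4) (not_lt.mp h3)]
  · rintro c -
    obtain ⟨r, hr⟩ := h c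
    obtain ⟨r, hr, hm⟩ := Finset.exists_min_image (Finset.univ.filter fun r => (c, r) ∈ T) id
      ⟨r, by simpa using hr⟩
    simp only [Finset.mem_filter, Finset.mem_univ, true_and, id] at hr hm
    refine ⟨(c, r), ?_, rfl⟩
    simp only [Finset.mem_coe, Finset.mem_filter]
    exact ⟨hr, fun ⟨r', h1, h2⟩ => absurd (hm r' h2) (not_le.mpr h1)⟩

open Classical in
theorem card_filter_not_hasLeft {T : Filling n n} (h : ∀ r : Fin n, ∃ c : Fin n, (c, r) ∈ T) :
    (T.filter fun d => ¬ HasLeft T d).card = n := by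
  refine Eq.trans ?_ (Finset.card_fin n)
  refine Finset.card_nbij (fun d => d.2) (by simp) ?_ ?_
  · rintro ⟨c, r⟩ h1 ⟨c', r'⟩ h2 rfl
    simp only [Finset.mem_coe, Finset.mem_filter] at h1 h2
    have h3 : ¬ c < c' := fun h3 => h2.2 ⟨c, h3, h1.1⟩
    have h4 : ¬ c' < c := fun h4 => h1.2 ⟨c', h4, h2.1⟩
    rw [le_antisymm (not_lt.mp h4) (not_lt.mp h3)]
  · rintro r -
    obtain ⟨c, hc⟩ := h r
    obtain ⟨c, hc, hm⟩ := Finset.exists_min_image (Finset.univ.filter fun c => (c, r) ∈ T) id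
      ⟨c, by simpa using hc⟩
    simp only [Finset.mem_filter, Finset.mem_univ, true_and, id] at hc hm
    refine ⟨(c, r), ?_, rfl⟩
    simp only [Finset.mem_coe, Finset.mem_filter]
    exact ⟨hc, fun ⟨c', h1, h2⟩ => absurd (hm c' h2) (not_le.mpr h1)⟩

open Classical in
/-- Counting dots by columns and by rows: if no dot has two parents, the number of parentless dots
is determined by the number of dots. -/
theorem card_add_card_parentless {T : Filling n n} (hr : ∀ r : Fin n, ∃ c : Fin n, (c, r) ∈ T)
    (hc : ∀ c : Fin n, ∃ r : Fin n, (c, r) ∈ T) (h : ∀ d ∈ T, HasAbove T d → ¬ HasLeft T d) :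
    T.card + (T.filter fun d => ¬ HasAbove T d ∧ ¬ HasLeft T d).card = n + n := by
  have h1 := Finset.card_union_add_card_inter (T.filter fun d => ¬ HasAbove T d)
    (T.filter fun d => ¬ HasLeft T d)
  rw [card_filter_not_hasAbove hc, card_filter_not_hasLeft hr, ← Finset.filter_or,
    ← Finset.filter_and, Finset.filter_true_of_mem (p := fun d => ¬ HasAbove T d ∨ ¬ HasLeft T d)
      (fun d hd => or_iff_not_imp_left.mpr fun h2 => h d hd (not_not.mp h2))] at h1
  exact h1

/-- A square filling without empty rows and columns has parentless dots in its first column and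
in its first row. -/
theorem exists_parentless {T : Filling n n} (hr : ∀ r : Fin n, ∃ c : Fin n, (c, r) ∈ T)
    (hc : ∀ c : Fin n, ∃ r : Fin n, (c, r) ∈ T) (z : Fin n) (hz : (z : ℕ) = 0) :
    (∃ r, (z, r) ∈ T ∧ ¬ HasAbove T (z, r) ∧ ¬ HasLeft T (z, r)) ∧
      ∃ c, (c, z) ∈ T ∧ ¬ HasAbove T (c, z) ∧ ¬ HasLeft T (c, z) := by
  have hz' : ∀ a, ¬ a < z := fun a h => by rw [Fin.lt_def] at h; omega
  constructor
  · obtain ⟨r, hr⟩ := hc z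
    obtain ⟨r, hr, hm⟩ := Finset.exists_min_image (Finset.univ.filter fun r => (z, r) ∈ T) id
      ⟨r, by simpa using hr⟩
    simp only [Finset.mem_filter, Finset.mem_univ, true_and, id] at hr hm
    exact ⟨r, hr, fun ⟨r', h1, h2⟩ => absurd (hm r' h2) (not_le.mpr h1), fun ⟨c, h1, _⟩ => hz' c h1⟩
  · obtain ⟨c, hc⟩ := hr z
    obtain ⟨c, hc, hm⟩ := Finset.exists_min_image (Finset.univ.filter fun c => (c, z) ∈ T) id
      ⟨c, by simpa using hc⟩
    simp only [Finset.mem_filter, Finset.mem_univ, true_and, id] at hc hm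
    exact ⟨c, hc, fun ⟨r, h1, _⟩ => hz' r h1, fun ⟨c', h1, h2⟩ => absurd (hm c' h2) (not_le.mpr h1)⟩

theorem dots_edges {π : Equiv.Perm (Fin n)} {T : Filling n n} (h : IsAssociated T π) :
    dots π (edges π T) = T := by
  ext ⟨a, r⟩
  obtain ⟨b, rfl⟩ := π.surjective r
  rw [mem_dots, mem_edges]
  by_cases hab : a = b
  · subst hab
    simpa using ((h (a, π a)).mpr rfl).1
  · simp [hab]

theorem edges_dots {π : Equiv.Perm (Fin n)} {S : Finset (Fin n × Fin n)} (h : ∀ a, (a, a) ∉ S) :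
    edges π (dots π S) = S := by
  ext ⟨a, b⟩
  rw [mem_edges, mem_dots]
  by_cases hab : a = b
  · subst hab
    simp [h]
  · simp [hab]

theorem good_edges {π : Equiv.Perm (Fin n)} {T : Filling n n} (hn : 0 < n) (hT : IsCNAT T)
    (hπ : IsAssociated T π) : Good pos (letter π) Finset.univ (edges π T) := by
  classical
  have hleaf : ∀ a, IsLeaf T (a, π a) := fun a => (hπ (a, π a)).mpr rfl
  have hinv : ∀ a b, (a, π b) ∈ T → a ≠ b → a < b ∧ π b < π a := by
    intro a b hab hne
    have h1 : ¬ π a < π b := fun h => (hleaf a).2.1 ⟨π b, h, hab⟩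
    have h2 : ¬ b < a := fun h => (hleaf b).2.2 ⟨a, h, hab⟩
    have h3 := π.injective.ne hne
    omega
  have htwo : ∀ d ∈ T, HasAbove T d → ¬ HasLeft T d := by
    rintro d hd h1 h2
    have htl : ¬ IsTopLeft d := by
      rintro ⟨h3, -⟩
      obtain ⟨c, h4, -⟩ := h2
      rw [Fin.lt_def] at h4
      omega
    rcases hT.unique_parent d hd htl with h | h
    · exact h.2 h2
    · exact h.2 h1
  refine ⟨?_, ?_, ?_, ?_, ?_⟩
  · intro a b hab
    rw [mem_edges] at hab
    exact ⟨Finset.mem_univ _, Finset.mem_univ _, inv_iff.mpr (hinv a b hab.2 hab.1)⟩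
  · intro a b c hab hbc
    rw [mem_edges] at hab hbc
    exact htwo (b, π b) (hleaf b).1 ⟨π c, (hinv b c hbc.2 hbc.1).2, hbc.2⟩
      ⟨a, (hinv a b hab.2 hab.1).1, hab.2⟩
  · intro a a' b b' h1 h2 h3 h4 h5
    rw [mem_edges] at h1 h2 h3
    exact htwo (a, π b) h1.2 ⟨π b', h5, h2.2⟩ ⟨a', h4, h3.2⟩
  · intro A _ hne hAP
    by_contra! hcross
    have hsame : ∀ a b, (a, π b) ∈ T → (a ∈ A ↔ b ∈ A) := by
      intro a b hab
      by_cases hne : a = b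
      · rw [hne]
      · have := hcross a b (mem_edges.mpr ⟨hne, hab⟩)
        tauto
    let z : Fin n := ⟨0, hn⟩
    -- Passing to the parent lowers the sum of the coordinates and keeps a row or a column, hence
    -- the side of the cut; every dot is traced back to the top-left cell.
    have hroot : ∀ N : ℕ, ∀ a b : Fin n, (a : ℕ) + π b ≤ N → (a, π b) ∈ T → (a ∈ A ↔ z ∈ A) := by
      intro N
      induction N with
      | zero =>
        intro a b h _
        rw [show a = z from Fin.ext (by change (a : ℕ) = 0; omega)]
      | succ N ih =>
        intro a b h hab
        by_cases htl : IsTopLeft (a, π b)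
        · rw [show a = z from Fin.ext htl.1]
        · rcases hT.unique_parent _ hab htl with ⟨⟨r, h1, h2⟩, -⟩ | ⟨⟨c, h1, h2⟩, -⟩
          · obtain ⟨b', rfl⟩ := π.surjective r
            rw [Fin.lt_def] at h1
            exact ih a b' (by dsimp only at h1; omega) h2
          · rw [Fin.lt_def] at h1
            rw [hsame a b hab, ← hsame c b h2]
            exact ih c b (by dsimp only at h1; omega) h2
    have hall : ∀ a, a ∈ A ↔ z ∈ A := fun a => hroot _ a a le_rfl (hleaf a).1
    obtain ⟨a, ha⟩ := hne
    exact hAP (Finset.eq_univ_of_forall fun b => (hall b).mpr ((hall a).mp ha))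
  · have h1 := card_add_card_parentless hT.row_nonempty hT.col_nonempty htwo
    let z : Fin n := ⟨0, hn⟩
    have htl : ∀ d ∈ T, ¬ HasAbove T d → ¬ HasLeft T d → d = (z, z) := by
      intro d hd h2 h3
      by_contra h4
      rcases hT.unique_parent d hd (fun h5 => h4 (Prod.ext (Fin.ext h5.1) (Fin.ext h5.2))) with h | h
      · exact h2 h.1
      · exact h3 h.1
    obtain ⟨r, hr1, hr2, hr3⟩ := (exists_parentless hT.row_nonempty hT.col_nonempty z rfl).1
    -- The top-left cell is the only parentless dot, so there are `2n - 1` dots; removing the `n`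
    -- leaves leaves `n - 1` edges.
    have h2 : (T.filter fun d => ¬ HasAbove T d ∧ ¬ HasLeft T d) = {(z, z)} := by
      ext d
      rw [Finset.mem_filter, Finset.mem_singleton]
      constructor
      · rintro ⟨h2, h3, h4⟩
        exact htl d h2 h3 h4
      · rintro rfl
        rw [← htl _ hr1 hr2 hr3]
        exact ⟨hr1, hr2, hr3⟩
    have h3 := card_dots (π := π) (S := edges π T) (fun a h => (mem_edges.mp h).1 rfl)
    rw [dots_edges hπ] at h3
    rw [h2, Finset.card_singleton] at h1
    rw [Finset.card_fin]
    omega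

theorem dots_mem_CNAT {π : Equiv.Perm (Fin n)} {S : Finset (Fin n × Fin n)} (hn : 0 < n)
    (hS : Good pos (letter π) Finset.univ S) : dots π S ∈ CNAT π := by
  classical
  have hinv : ∀ a b, (a, b) ∈ S → a < b ∧ π b < π a := fun a b h =>
    inv_iff.mp (hS.mem_inv a b h).2.2
  have hloop : ∀ a, (a, a) ∉ S := fun a h => (hinv a a h).1.false
  have hdiag : ∀ a, (a, π a) ∈ dots π S := fun a => mem_dots.mpr (Or.inr rfl)
  have hrow : ∀ r : Fin n, ∃ c : Fin n, (c, r) ∈ dots π S := by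
    intro r
    obtain ⟨a, rfl⟩ := π.surjective r
    exact ⟨a, hdiag a⟩
  have hcol : ∀ c : Fin n, ∃ r : Fin n, (c, r) ∈ dots π S := fun c => ⟨_, hdiag c⟩
  have hle : ∀ a b, (a, π b) ∈ dots π S → a ≤ b ∧ π b ≤ π a := by
    intro a b hab
    rcases mem_dots.mp hab with h | rfl
    · exact ⟨(hinv a b h).1.le, (hinv a b h).2.le⟩
    · exact ⟨le_rfl, le_rfl⟩
  have hnb : ∀ a, ¬ HasBelow (dots π S) (a, π a) := by
    rintro a ⟨r, h1, h2⟩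
    obtain ⟨b, rfl⟩ := π.surjective r
    exact absurd (hle a b h2).2 (not_le.mpr h1)
  have hnr : ∀ a, ¬ HasRight (dots π S) (a, π a) := by
    rintro a ⟨b, h1, h2⟩
    exact absurd (hle b a h2).1 (not_le.mpr h1)
  have hint : ∀ a b, (a, b) ∈ S → HasBelow (dots π S) (a, π b) ∧ HasRight (dots π S) (a, π b) :=
    fun a b hab => ⟨⟨π a, (hinv a b hab).2, hdiag a⟩, ⟨b, (hinv a b hab).1, hdiag b⟩⟩
  have htwo : ∀ d ∈ dots π S, HasAbove (dots π S) d → ¬ HasLeft (dots π S) d := by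
    rintro ⟨a, r⟩ hd ⟨r', h1, h2⟩ ⟨a', h3, h4⟩
    obtain ⟨b, rfl⟩ := π.surjective r
    obtain ⟨b', rfl⟩ := π.surjective r'
    dsimp only at h1 h2 h3 h4
    have hab' : (a, b') ∈ S := by
      refine (mem_dots.mp h2).resolve_right ?_
      rintro rfl
      exact absurd (hle a b hd).2 (not_le.mpr h1)
    have ha'b : (a', b) ∈ S := by
      refine (mem_dots.mp h4).resolve_right ?_
      rintro rfl
      exact absurd (hle a a' hd).1 (not_le.mpr h3)
    rcases mem_dots.mp hd with hab | rfl
    · exact hS.corner a a' b b' hab hab' ha'b h3 h1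
    · exact hS.pure a' a b' ha'b hab'
  -- With `n - 1` edges and `n` leaves there is exactly one parentless dot. Both the first column
  -- and the first row contain one, so it is the top-left cell.
  have hcard := card_add_card_parentless hrow hcol htwo
  rw [card_dots hloop] at hcard
  have hcard' := hS.card
  rw [Finset.card_fin] at hcard'
  obtain ⟨p, hp⟩ := Finset.card_eq_one.mp (by omega : (Finset.card
    ((dots π S).filter fun d => ¬ HasAbove (dots π S) d ∧ ¬ HasLeft (dots π S) d)) = 1)
  have hpeq : ∀ d ∈ dots π S, ¬ HasAbove (dots π S) d → ¬ HasLeft (dots π S) d → d = p := by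
    intro d h1 h2 h3
    rw [← Finset.mem_singleton, ← hp, Finset.mem_filter]
    exact ⟨h1, h2, h3⟩
  obtain ⟨⟨r, hr1, hr2, hr3⟩, ⟨c, hc1, hc2, hc3⟩⟩ := exists_parentless hrow hcol ⟨0, hn⟩ rfl
  have hr := hpeq _ hr1 hr2 hr3
  have hc := hpeq _ hc1 hc2 hc3
  have hptl : IsTopLeft p := ⟨by rw [← hr], by rw [← hc]⟩
  refine ⟨⟨⟨hrow, hcol, fun d hd htl => ?_⟩, ?_⟩, ?_⟩
  · by_cases h1 : HasAbove (dots π S) d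
    · exact Or.inl ⟨h1, htwo d hd h1⟩
    · by_cases h2 : HasLeft (dots π S) d
      · exact Or.inr ⟨h2, h1⟩
      · exact absurd (hpeq d hd h1 h2 ▸ hptl) htl
  · rintro ⟨a, r⟩ hd
    obtain ⟨b, rfl⟩ := π.surjective r
    rcases mem_dots.mp hd with hab | rfl
    · exact Or.inl (hint a b hab)
    · exact Or.inr ⟨hnb a, hnr a⟩
  · rintro ⟨a, r⟩
    obtain ⟨b, rfl⟩ := π.surjective r
    constructor
    · rintro ⟨hd, h1, -⟩
      rcases mem_dots.mp hd with hab | rfl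
      · exact absurd (hint a b hab).1 h1
      · rfl
    · intro h
      obtain rfl : b = a := π.injective h
      exact ⟨hdiag b, hnb b, hnr b⟩

/-- Complete non-ambiguous trees are the good spanning trees of the inversion graph. -/
theorem cnat_eq_count (π : Equiv.Perm (Fin n)) (hn : 0 < n) :
    cnat π = count pos (letter π) Finset.univ := by
  refine Set.ncard_congr (fun T _ => edges π T) (fun T hT => good_edges hn hT.1 hT.2) ?_ ?_
  · intro T T' hT hT' h
    rw [← dots_edges hT.2, ← dots_edges hT'.2, h]
  · intro S hS
    exact ⟨dots π S, dots_mem_CNAT hn hS,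
      edges_dots fun a h => (Good.mem_inv hS a a h).2.2.ne rfl⟩

/-! ### The theorem for permutations -/

theorem cnat_eq_three_iff {π : Equiv.Perm (Fin n)} (hπ : ¬ Reducible π) :
    cnat π = 3 ↔ (∃! f : Fin 4 → Fin n, IsOccurrence p3412 π f) ∧ Avoids π p321 := by
  rcases Nat.eq_zero_or_pos n with rfl | hn
  · refine iff_of_false (fun h => ?_) (fun ⟨⟨f, _⟩, _⟩ => (f 0).elim0)
    have h1 : cnat π ≤ 1 := by
      rw [cnat, Set.ncard_le_one (Set.toFinite _)]
      intro T _ T' _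
      ext ⟨a, b⟩
      exact a.elim0
    omega
  · rw [cnat_eq_count π hn, (cut_univ hπ).count_eq_three_iff pos_injective (letter_injective π)
      ⟨⟨0, hn⟩, Finset.mem_univ _⟩ Finset.mem_univ, avoids_p321_iff]
    refine and_congr_left fun _ => ?_
    constructor
    · rintro ⟨a, b, c, d, h, huniq⟩
      refine ⟨![a, b, c, d], isOccurrence_p3412_iff.mpr h, fun f hf => ?_⟩
      obtain ⟨h1, h2, h3, h4⟩ := huniq _ _ _ _ (isOccurrence_p3412_iff.mp hf)
      ext i
      fin_cases i <;> simp [*]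
    · rintro ⟨f, hf, huniq⟩
      refine ⟨f 0, f 1, f 2, f 3, isOccurrence_p3412_iff.mp hf, fun a b c d h => ?_⟩
      have := huniq ![a, b, c, d] (isOccurrence_p3412_iff.mpr h)
      subst this
      simp

/-- The inner letters of a unique `3412` in a `321`-avoiding permutation are adjacent, both in
position and in value. -/
theorem IsOccurrence.adjacent {π : Equiv.Perm (Fin n)} {f : Fin 4 → Fin n}
    (hf : IsOccurrence p3412 π f) (huniq : ∀ g, IsOccurrence p3412 π g → g = f)
    (h321 : Avoids π p321) :
    (f 2 : ℕ) = (f 1 : ℕ) + 1 ∧ (π (f 0) : ℕ) = (π (f 3) : ℕ) + 1 := by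
  have huniq' : ∀ a b c d, Pat pos (letter π) a b c d →
      a = f 0 ∧ b = f 1 ∧ c = f 2 ∧ d = f 3 := by
    intro a b c d h
    have := huniq ![a, b, c, d] (isOccurrence_p3412_iff.mpr h)
    subst this
    simp
  rw [avoids_p321_iff] at h321
  obtain ⟨h1, h2, h3, h4, h5, h6⟩ := isOccurrence_p3412_iff.mp hf
  have hne : ∀ m z : Fin n, pos m ≠ pos z ↔ letter π m ≠ letter π z := fun m z => by
    rw [(pos_injective).ne_iff, (letter_injective π).ne_iff]
  -- A letter placed between the `4` and the `1` could replace the `4` if larger than it, or the `1`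
  -- if smaller than it; otherwise it is the middle of a `321`.
  have hpos : ∀ m : Fin n, ¬ (pos (f 1) < pos m ∧ pos m < pos (f 2)) := by
    rintro m ⟨h7, h8⟩
    have e1 := (hne m (f 1)).mp (by omega)
    have e2 := (hne m (f 2)).mp (by omega)
    by_cases c1 : letter π (f 1) < letter π m
    · have := (huniq' (f 0) m (f 2) (f 3) ⟨by omega, by omega, h3, h4, h5, by omega⟩).2.1
      rw [this] at h7
      omega
    · by_cases c2 : letter π m < letter π (f 2)
      · have := (huniq' (f 0) (f 1) m (f 3) ⟨by omega, by omega, by omega, by omega, h5, h6⟩).2.2.1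
        rw [this] at h8
        omega
      · exact h321 (f 1) m (f 2) ⟨by omega, by omega⟩ ⟨by omega, by omega⟩
  -- Dually, a value between the `2` and the `3` could replace the `3` if it stands before it, or
  -- the `2` if it stands after it; otherwise it is the middle of a `321`.
  have hval : ∀ m : Fin n, ¬ (letter π (f 3) < letter π m ∧ letter π m < letter π (f 0)) := by
    rintro m ⟨h7, h8⟩
    have e1 := (hne m (f 0)).mpr (by omega)
    have e2 := (hne m (f 3)).mpr (by omega)
    by_cases c1 : pos m < pos (f 0)
    · have := (huniq' m (f 1) (f 2) (f 3) ⟨by omega, h2, h3, h4, by omega, by omega⟩).1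
      rw [this] at h8
      omega
    · by_cases c2 : pos (f 3) < pos m
      · have := (huniq' (f 0) (f 1) (f 2) m ⟨h1, h2, by omega, by omega, by omega, h6⟩).2.2.2
        rw [this] at h7
        omega
      · exact h321 (f 0) m (f 3) ⟨by omega, by omega⟩ ⟨by omega, by omega⟩
  unfold pos at hpos h2
  unfold letter at hval h5
  constructor
  · by_contra h
    exact hpos ⟨f 1 + 1, by omega⟩ ⟨by simp, by simp; omega⟩
  · by_contra h
    refine hval (π.symm ⟨π (f 3) + 1, by omega⟩) ?_
    rw [Equiv.apply_symm_apply]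
    exact ⟨by simp, by simp; omega⟩

end CNATPattern

theorem mainTheorem12 {n : ℕ} (π : Equiv.Perm (Fin n)) (hπ : ¬ CNATPattern.Reducible π) :
    (CNATPattern.cnat π = 3 ↔
      (∃! f : Fin 4 → Fin n, CNATPattern.IsOccurrence CNATPattern.p3412 π f) ∧
        CNATPattern.Avoids π CNATPattern.p321) ∧
    (CNATPattern.cnat π = 3 →
      ∀ f : Fin 4 → Fin n, CNATPattern.IsOccurrence CNATPattern.p3412 π f →
        (f 2 : ℕ) = (f 1 : ℕ) + 1 ∧ (π (f 0) : ℕ) = (π (f 3) : ℕ) + 1) := by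
  refine ⟨CNATPattern.cnat_eq_three_iff hπ, fun h f hf => ?_⟩
  obtain ⟨huniq, h321⟩ := (CNATPattern.cnat_eq_three_iff hπ).mp h
  exact hf.adjacent (fun g hg => huniq.unique hg hf) h321
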